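/- Let $H$ be a separable infinite-dimensional real Hilbert space, $(\Omega,\mathsf P)$ and $(\mathcal T,\mu)$ standard probability spaces. A generalized $H$-valued function on $(\mathcal T,\mu)$ is a continuous linear operator $Y:H\to L^0(\mathcal T,\mu)$ ($L^0$ with the topology of convergence in measure), written $\xi\mapsto\langle Y,\xi\rangle$; it is identified with the sequence of its coordinates $Y(t)=(\langle Y(t),e_n\rangle)_n\in\mathbb R^\infty$ in a fixed orthonormal basis $(e_n)$ of $H$. Let $X$ be a standard Gaussian in $H$ defined on $(\Omega,\mathsf P)$, i.e. a generalized $H$-valued function on $(\Omega,\mathsf P)$ with $\langle X,\xi\rangle\sim N(0,\|\xi\|^2)$ for all $\xi\in H$. $Y$ is a randomized shift if $\mathrm{Law}_{\mathsf P\otimes\mu}[X+Y]\ll\mathrm{Law}_{\mathsf P}[X]$. A GMC over $(X,Y)$ is a random finite positive measure $M=M(X,dt)$ on $\mathcal T$, measurable with respect to $X$, such that $\mathsf E M\ll\mu$ and, for every $\xi\in H$, $M(X+\xi,dt)=e^{\langle Y(t),\xi\rangle}M(X,dt)$ a.s.; it is subcritical if $\mathsf E M$ is $\sigma$-finite. Let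 $Z,W$ be randomized shifts defined on $(\mathcal T,\mu)$ and let $M_Z,M_W$ be corresponding subcritical GMCs, with $\mathsf E M_Z=\mathsf E M_W=\mu$. Then: (0) The kernel $K_{ZW}(t,s)=\langle Z(t),W(s)\rangle$ is well defined as a function on $\mathcal T\times\mathcal T$ up to $\mu\otimes\mu$-a.e. equality: there is a measurable $K_{ZW}:\mathcal T\times\mathcal T\to\mathbb R$ for which there exists a probability measure $\mu'\sim\mu$ such that all $\langle Z,\xi\rangle,\langle W,\xi\rangle$ are in $L^2(\mu')$, $K_{ZW}\in L^2(\mu'\otimes\mu')$, and $$\int K_{ZW}(t,s)f(t)g(s)\,\mu'(dt)\mu'(ds)=\Big\langle\int f(t)Z(t)\,\mu'(dt),\int g(s)W(s)\,\mu'(ds)\Big\rangle_H$$ for all $f,g\in L^2(\mu')$ (weak integrals); and any two such functions agree $\mu\otimes\mu$-a.e. (1) For $\mathsf P\otimes\mu$-a.e. $(\omega,s)$, $M_Z(X+W(s),dt)=e^{K_{ZW}(t,s)}M_Z(X,dt)$ as measures on $\mathcal T$. (2) $\mathsf E[M_Z(X)\otimes M_W(X)]=e^{K_{ZW}}\cdot\mu\otimes\mu$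 as measures on $\mathcal T\times\mathcal T$. (3) If $\mu$ has no atoms, then almost surely $M_Z$ has no atoms. -/

import Mathlib

open MeasureTheory ProbabilityTheory Filter Topology
open scoped ENNReal NNReal

noncomputable section

namespace GMC

/-- A generalized `H`-valued function on `(T, μ)`: a continuous linear operator from `H` to
`L⁰(μ)`, the space of `μ`-classes of measurable functions with the topology of convergence in
measure.  Both `H` and `L⁰(μ)` (for finite `μ`) are metrizable, so continuity is sequential
continuity. -/
structure GenFun (H : Type*) [NormedAddCommGroup H] [InnerProductSpace ℝ H]
    {T : Type*} [MeasurableSpace T] (μ : Measure T) where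
  toLin : H →ₗ[ℝ] (T →ₘ[μ] ℝ)
  cont : ∀ (u : ℕ → H) (ξ : H), Tendsto u atTop (𝓝 ξ) →
    TendstoInMeasure μ (fun n => (toLin (u n) : T → ℝ)) atTop (toLin ξ : T → ℝ)

section

variable {H : Type*} [NormedAddCommGroup H] [InnerProductSpace ℝ H]
  {Ω T : Type*} [MeasurableSpace Ω] [MeasurableSpace T]

/-- The scalar product `⟨Y(t), ξ⟩`, as a function of `t` (a representative of its class). -/
def GenFun.pair {μ : Measure T} (Y : GenFun H μ) (ξ : H) (t : T) : ℝ := Y.toLin ξ t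

/-- The value `Y(t)`, identified with its sequence of coordinates in an orthonormal basis. -/
def GenFun.coords {μ : Measure T} (e : HilbertBasis ℕ ℝ H) (Y : GenFun H μ) (t : T) : ℕ → ℝ :=
  fun n => Y.pair (e n) t

/-- The sequence of coordinates of a vector `ξ ∈ H`. -/
def vecCoords (e : HilbertBasis ℕ ℝ H) (ξ : H) : ℕ → ℝ := fun n => inner ℝ (e n) ξ

theorem GenFun.measurable_pair {μ : Measure T} (Y : GenFun H μ) (ξ : H) :
    Measurable (Y.pair ξ) := (Y.toLin ξ).measurable

theorem GenFun.measurable_coords {μ : Measure T} (e : HilbertBasis ℕ ℝ H) (Y : GenFun H μ) :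
    Measurable (Y.coords e) := measurable_pi_lambda _ fun n => Y.measurable_pair (e n)

/-- A generalized random vector `X` is standard Gaussian if every `⟨X, ξ⟩` is a centered
Gaussian variable with variance `‖ξ‖²`. -/
def IsStdGaussian {P : Measure Ω} (X : GenFun H P) : Prop :=
  ∀ ξ : H, P.map (X.pair ξ) = gaussianReal 0 (‖ξ‖₊ ^ 2)

/-- `Y` is a randomized shift of `X`: the law of `X + Y` under `P ⊗ μ` is absolutely continuous
with respect to the law of `X`. -/
def IsRandomizedShift {P : Measure Ω} {μ : Measure T} (e : HilbertBasis ℕ ℝ H)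
    (X : GenFun H P) (Y : GenFun H μ) : Prop :=
  (P.prod μ).map (fun p : Ω × T => X.coords e p.1 + Y.coords e p.2) ≪ P.map (X.coords e)

/-- The expectation `E M` of the random measure `ω ↦ M(X(ω), dt)`. -/
def expectation {P : Measure Ω} (e : HilbertBasis ℕ ℝ H) (X : GenFun H P)
    (M : Kernel (ℕ → ℝ) T) : Measure T :=
  P.bind fun ω => M (X.coords e ω)

/-- `E M [A] = E (M [A])`. -/
theorem expectation_apply {P : Measure Ω} (e : HilbertBasis ℕ ℝ H) (X : GenFun H P)
    (M : Kernel (ℕ → ℝ) T) {A : Set T} (hA : MeasurableSet A) :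
    expectation e X M A = ∫⁻ ω, M (X.coords e ω) A ∂P :=
  Measure.bind_apply hA (M.measurable.comp (X.measurable_coords e)).aemeasurable

/-- `M` is a Gaussian multiplicative chaos over `(X, Y)`.  Measurability of the random measure
with respect to `X` is expressed by giving it as a measurable functional `x ↦ M(x, dt)` of
(the coordinates of) `X`. -/
structure IsGMC {P : Measure Ω} {μ : Measure T} (e : HilbertBasis ℕ ℝ H)
    (X : GenFun H P) (Y : GenFun H μ) (M : Kernel (ℕ → ℝ) T) : Prop where
  finite : ∀ᵐ ω ∂P, IsFiniteMeasure (M (X.coords e ω))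
  expectation_ac : expectation e X M ≪ μ
  shift : ∀ ξ : H, ∀ᵐ ω ∂P,
    M (X.coords e ω + vecCoords e ξ) =
      (M (X.coords e ω)).withDensity fun t => ENNReal.ofReal (Real.exp (Y.pair ξ t))

/-- A GMC is subcritical if its expectation is `σ`-finite. -/
structure IsSubcriticalGMC {P : Measure Ω} {μ : Measure T} (e : HilbertBasis ℕ ℝ H)
    (X : GenFun H P) (Y : GenFun H μ) (M : Kernel (ℕ → ℝ) T) : Prop
    extends IsGMC e X Y M where
  sigmaFinite : SigmaFinite (expectation e X M)

/-- `a = ∫ f(t) Y(t) μ'(dt)`, the weak (Pettis) integral. -/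
def IsWeakIntegral {μ : Measure T} (μ' : Measure T) (f : T → ℝ) (Y : GenFun H μ) (a : H) : Prop :=
  ∀ ξ : H, Integrable (fun t => f t * Y.pair ξ t) μ' ∧
    inner ℝ a ξ = ∫ t, f t * Y.pair ξ t ∂μ'

/-- The function `K` is the covariance kernel `K(t, s) = ⟨Z(t), W(s)⟩`: for some probability
measure `μ'` equivalent to `μ`, under which all linear functionals of `Z` and `W` are square
integrable, `K` is the Hilbert-Schmidt kernel of the bilinear form
`(f, g) ↦ ⟨∫ f Z dμ', ∫ g W dμ'⟩` on `L²(μ')`. -/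
structure IsCovKernel {μ : Measure T} (Z W : GenFun H μ) (K : T × T → ℝ) : Prop where
  measurable : Measurable K
  kernel : ∃ μ' : Measure T, IsProbabilityMeasure μ' ∧ μ' ≪ μ ∧ μ ≪ μ' ∧
    (∀ ξ : H, MemLp (Z.pair ξ) 2 μ') ∧ (∀ ξ : H, MemLp (W.pair ξ) 2 μ') ∧
    MemLp K 2 (μ'.prod μ') ∧
    ∀ f g : T → ℝ, MemLp f 2 μ' → MemLp g 2 μ' →
      ∃ a b : H, IsWeakIntegral μ' f Z a ∧ IsWeakIntegral μ' g W b ∧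
        ∫ p : T × T, K p * (f p.1 * g p.2) ∂(μ'.prod μ') = inner ℝ a b

end

end GMC

end

open MeasureTheory ProbabilityTheory Filter Topology
open scoped ENNReal NNReal

/-! In coordinates `X` becomes a standard Gaussian sequence with law `γ` on `ℝ^∞`, and `Z`, `W`
become measurable maps `z`, `w` into `ℝ^∞`. For the shift by the first `n` coordinates of `w(s)`,
claim (1) is the defining property of the chaos, with `Kₙ(t, s) = ∑_{k<n} zₖ(t) wₖ(s)` in the
exponent. The work lies in letting `n → ∞` on both sides.

Convergence of `Kₙ`. For a randomized shift, some equivalent probability measure `μ'` makes linear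
and quadratic forms in `z` bounded in `L²(μ')` by their Gaussian counterparts (`exists_weight`).
Take as quadratic form the Gram matrix of `z` itself: its mean is the squared Hilbert–Schmidt norm
`S` of that matrix, so `S² ≤ R S` and `S ≤ R` (`hsq_gram_le`). The squared `L²(μ' ⊗ μ')` norm of a
partial sum is the scalar product of two Gram blocks, hence `Kₙ` is Cauchy (`exists_kernel`), and
Parseval identifies the limit as the covariance kernel.

Convergence of `M(x + wⁿ)`. The law of `x + α w`, `0 ≤ α ≤ 1` coordinatewise, is absolutely
continuous with respect to `γ` uniformly in `α` (`lintegral_shift_le`): write `x` as `β x' + α x`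
with independent copies and `α² + β² = 1`. So a merely measurable functional can be replaced by a
continuous one, and it converges along `αⱼ → a`.

Exchange of limit and integral. The integral of `exp Kₙ` against `M(x)` is the total mass of `M(x +
wⁿ)`, which stays bounded along a subsequence. This makes `exp (θ Kₙ)` uniformly integrable only for
`θ < 1`, so (1) is first proved for the shift `θ w`, and then `θ → 1` (`IsChaos.ae_shift_apply`).

Second moments. Under `M_W(x, ds) γ(dx)` the pair `(x, s)` is distributed as `(x + w(s), s)` under
`γ ⊗ μ` (`IsChaos.compProd_eq`). Thus `E[M_Z ⊗ M_W]` is the mean of `M_Z(x + w(s), dt) μ(ds)`, and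
(1) with `E M_Z = μ` gives (2). Claim (3) is (2) for the pair `Z, Z`, evaluated on the diagonal. -/

namespace GMC

/-! ### Measures determined by exponential moments -/

/-- Finite measures on a Polish vector space are determined by the moment generating functions
of a separating family of continuous functionals, if these are finite. -/
theorem ext_of_lintegral_exp {V W : Type*} [AddCommGroup V] [Module ℝ V] [TopologicalSpace V]
    [PolishSpace V] [MeasurableSpace V] [BorelSpace V] [AddCommGroup W] [Module ℝ W]
    (L : V →ₗ[ℝ] W →ₗ[ℝ] ℝ) (hL : ∀ w, Continuous fun v => L v w) (hL' : ∀ v ≠ 0, L v ≠ 0)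
    {P P' : Measure V} [IsFiniteMeasure P] [IsFiniteMeasure P']
    (h : ∀ w, ∫⁻ v, ENNReal.ofReal (Real.exp (L v w)) ∂P
      = ∫⁻ v, ENNReal.ofReal (Real.exp (L v w)) ∂P')
    (hfin : ∀ w, ∫⁻ v, ENNReal.ofReal (Real.exp (L v w)) ∂P ≠ ∞) : P = P' := by
  let := TopologicalSpace.upgradeIsCompletelyMetrizable V
  -- The discrete topology on `W` makes joint continuity of the pairing the same as continuity in
  -- `v` for each `w`.
  let : TopologicalSpace W := ⊥
  have : DiscreteTopology W := ⟨rfl⟩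
  have hLc : Continuous fun p : V × W => L p.1 p.2 := by
    rw [continuous_prod_of_discrete_right]
    exact hL
  refine ext_of_integral_char_eq (L := L) Real.continuous_probChar Real.probChar_ne_one hL' hLc
    fun w => ?_
  have key : ∀ {Q : Measure V} (t : ℝ), ∫⁻ v, ENNReal.ofReal (Real.exp (L v (t • w))) ∂Q ≠ ∞ →
      Integrable (fun v => Real.exp (t * L v w)) Q := by
    intro Q t ht
    have hm : Measurable fun v => Real.exp (t * L v w) :=
      ((hL w).measurable.const_mul t).exp
    refine ⟨hm.aestronglyMeasurable, ?_⟩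
    rw [hasFiniteIntegral_iff_ofReal (ae_of_all _ fun _ => (Real.exp_pos _).le)]
    simpa [lt_top_iff_ne_top] using ht
  have hi : ∀ t : ℝ, Integrable (fun v => Real.exp (t * L v w)) P := fun t => key t (hfin _)
  have hm : mgf (fun v => L v w) P = mgf (fun v => L v w) P' := by
    funext t
    have e : ∀ Q : Measure V, mgf (fun v => L v w) Q t
        = (∫⁻ v, ENNReal.ofReal (Real.exp (L v (t • w))) ∂Q).toReal := by
      intro Q
      rw [mgf, integral_eq_lintegral_of_nonneg_ae (ae_of_all _ fun _ => (Real.exp_pos _).le)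
        (((hL w).measurable.const_mul t).exp).aestronglyMeasurable]
      simp
    rw [e, e, h]
  -- The measures need not be probability measures; the exponential moment at `w = 0` is the total
  -- mass.
  have h0 : P = 0 ↔ P' = 0 := by
    have := h 0
    simp only [map_zero, Real.exp_zero, ENNReal.ofReal_one, lintegral_const, one_mul] at this
    rw [← Measure.measure_univ_eq_zero, this, Measure.measure_univ_eq_zero]
  have hset : integrableExpSet (fun v => L v w) P = Set.univ :=
    Set.eq_univ_of_forall fun t => hi t
  -- The moment generating functions are finite on all of `ℝ`, so they extend analytically to `ℂ`;
  -- the value at `I` is the characteristic function.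
  have := eqOn_complexMGF_of_mgf' hm h0 (x := Complex.I) (by simp [hset])
  simp only [complexMGF] at this
  simp only [BoundedContinuousFunction.char_apply, Real.probChar_apply]
  simpa [mul_comm] using this

/-! ### Finitely supported functionals on `ℝ^∞` -/

/-- The linear functional `x ↦ ∑ₖ cₖ xₖ` on `ℝ^∞`, for a finitely supported `c`. -/
noncomputable def lf (c : ℕ →₀ ℝ) (x : ℕ → ℝ) : ℝ := c.sum fun k a => a * x k

/-- The squared norm of a finitely supported sequence. -/
noncomputable def nsq (c : ℕ →₀ ℝ) : ℝ := c.sum fun _ a => a ^ 2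

theorem lf_add_left (c d : ℕ →₀ ℝ) (x : ℕ → ℝ) : lf (c + d) x = lf c x + lf d x :=
  Finsupp.sum_add_index' (by simp) (by intros; ring)

theorem lf_smul_left (a : ℝ) (c : ℕ →₀ ℝ) (x : ℕ → ℝ) : lf (a • c) x = a * lf c x := by
  unfold lf
  rw [Finsupp.sum_smul_index (by simp), Finsupp.mul_sum]
  simp [mul_assoc]

theorem lf_add (c : ℕ →₀ ℝ) (x y : ℕ → ℝ) : lf c (x + y) = lf c x + lf c y := by
  simp [lf, Finsupp.sum, mul_add, Finset.sum_add_distrib]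

theorem lf_smul (c : ℕ →₀ ℝ) (a : ℝ) (x : ℕ → ℝ) : lf c (a • x) = a * lf c x := by
  simp [lf, Finsupp.sum, Finset.mul_sum, mul_left_comm]

theorem lf_neg (c : ℕ →₀ ℝ) (x : ℕ → ℝ) : lf c (-x) = - lf c x := by
  simp [lf, Finsupp.sum]

theorem lf_single (k : ℕ) (a : ℝ) (x : ℕ → ℝ) : lf (Finsupp.single k a) x = a * x k := by
  simp [lf]

theorem lf_comm (c d : ℕ →₀ ℝ) : lf c d = lf d c := by
  have h : ∀ a b : ℕ →₀ ℝ, lf a b = ∑ k ∈ a.support ∪ b.support, a k * b k := by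
    intro a b
    exact Finsupp.sum_of_support_subset _ Finset.subset_union_left _ (by simp)
  rw [h, h, Finset.union_comm]
  simp [mul_comm]

theorem lf_self (c : ℕ →₀ ℝ) : lf c c = nsq c := by
  simp [lf, nsq, Finsupp.sum, pow_two]

theorem nsq_nonneg (c : ℕ →₀ ℝ) : 0 ≤ nsq c := Finset.sum_nonneg fun _ _ => sq_nonneg _

theorem nsq_smul (a : ℝ) (c : ℕ →₀ ℝ) : nsq (a • c) = a ^ 2 * nsq c := by
  rw [← lf_self, ← lf_self, lf_smul_left, Finsupp.coe_smul, lf_smul]; ring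

theorem nsq_add (c d : ℕ →₀ ℝ) : nsq (c + d) = nsq c + 2 * lf c d + nsq d := by
  rw [← lf_self, lf_add_left, Finsupp.coe_add, lf_add, lf_add, lf_self, lf_self, lf_comm d c]; ring

/-- The action of a diagonal matrix on finitely supported sequences. -/
noncomputable def diag (α : ℕ → ℝ) (c : ℕ →₀ ℝ) : ℕ →₀ ℝ :=
  Finsupp.onFinset c.support (fun k => α k * c k) fun k hk => by
    simp only [Finsupp.mem_support_iff]
    exact right_ne_zero_of_mul hk

theorem lf_diag (α : ℕ → ℝ) (c : ℕ →₀ ℝ) (x : ℕ → ℝ) : lf (diag α c) x = lf c (α * x) := by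
  unfold lf diag
  rw [Finsupp.onFinset_sum _ (by simp)]
  refine Finset.sum_congr rfl fun k _ => ?_
  simp only [Pi.mul_apply]
  ring

theorem nsq_diag_add {α β : ℕ → ℝ} (h : ∀ k, α k ^ 2 + β k ^ 2 = 1) (c : ℕ →₀ ℝ) :
    nsq (diag α c) + nsq (diag β c) = nsq c := by
  unfold nsq diag
  rw [Finsupp.onFinset_sum _ (by simp), Finsupp.onFinset_sum _ (by simp), Finsupp.sum,
    ← Finset.sum_add_distrib]
  refine Finset.sum_congr rfl fun k _ => ?_
  linear_combination (c k) ^ 2 * h k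

theorem continuous_lf (c : ℕ →₀ ℝ) : Continuous (lf c) := by
  unfold lf Finsupp.sum
  fun_prop

@[fun_prop]
theorem measurable_lf (c : ℕ →₀ ℝ) : Measurable (lf c) := (continuous_lf c).measurable

/-- The pairing of `ℝ^∞` with finitely supported sequences. -/
noncomputable def lfₗ : (ℕ → ℝ) →ₗ[ℝ] (ℕ →₀ ℝ) →ₗ[ℝ] ℝ :=
  LinearMap.mk₂ ℝ (fun x c => lf c x) (fun x y c => lf_add c x y) (fun a x c => lf_smul c a x)
    (fun x c d => lf_add_left c d x) (fun a x c => lf_smul_left a c x)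

theorem lfₗ_apply (x : ℕ → ℝ) (c : ℕ →₀ ℝ) : lfₗ x c = lf c x := rfl

theorem lfₗ_ne_zero {x : ℕ → ℝ} (hx : x ≠ 0) : lfₗ x ≠ 0 := by
  obtain ⟨k, hk⟩ := Function.ne_iff.1 hx
  refine fun h => hk ?_
  have := LinearMap.congr_fun h (Finsupp.single k 1)
  simpa [lfₗ_apply, lf_single] using this

theorem ext_of_lintegral_exp_lf {P P' : Measure (ℕ → ℝ)} [IsFiniteMeasure P] [IsFiniteMeasure P']
    (h : ∀ c, ∫⁻ x, ENNReal.ofReal (Real.exp (lf c x)) ∂P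
      = ∫⁻ x, ENNReal.ofReal (Real.exp (lf c x)) ∂P')
    (hfin : ∀ c, ∫⁻ x, ENNReal.ofReal (Real.exp (lf c x)) ∂P ≠ ∞) : P = P' :=
  ext_of_lintegral_exp lfₗ continuous_lf (fun _ => lfₗ_ne_zero) h hfin

theorem ext_of_lintegral_exp_lf_prod {P P' : Measure ((ℕ → ℝ) × (ℕ → ℝ))} [IsFiniteMeasure P]
    [IsFiniteMeasure P']
    (h : ∀ c d, ∫⁻ p, ENNReal.ofReal (Real.exp (lf c p.1 + lf d p.2)) ∂P
      = ∫⁻ p, ENNReal.ofReal (Real.exp (lf c p.1 + lf d p.2)) ∂P')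
    (hfin : ∀ c d, ∫⁻ p, ENNReal.ofReal (Real.exp (lf c p.1 + lf d p.2)) ∂P ≠ ∞) : P = P' := by
  let L : ((ℕ → ℝ) × (ℕ → ℝ)) →ₗ[ℝ] ((ℕ →₀ ℝ) × (ℕ →₀ ℝ)) →ₗ[ℝ] ℝ :=
    LinearMap.mk₂ ℝ (fun p q => lf q.1 p.1 + lf q.2 p.2)
      (by intros; simp only [Prod.fst_add, Prod.snd_add, lf_add]; ring)
      (by intros; simp only [Prod.smul_fst, Prod.smul_snd, lf_smul, smul_eq_mul]; ring)
      (by intros; simp only [Prod.fst_add, Prod.snd_add, lf_add_left]; ring)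
      (by intros; simp only [Prod.smul_fst, Prod.smul_snd, lf_smul_left, smul_eq_mul]; ring)
  have hLa : ∀ p q, L p q = lf q.1 p.1 + lf q.2 p.2 := fun _ _ => rfl
  refine ext_of_lintegral_exp L (fun q => ?_) (fun p hp hL => hp ?_) (fun q => h q.1 q.2)
    (fun q => hfin q.1 q.2)
  · exact ((continuous_lf _).comp continuous_fst).add ((continuous_lf _).comp continuous_snd)
  · refine Prod.ext (funext fun k => ?_) (funext fun k => ?_)
    · have := LinearMap.congr_fun hL (Finsupp.single k 1, 0)
      simpa [hLa, lf_single, lf] using this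
    · have := LinearMap.congr_fun hL (0, Finsupp.single k 1)
      simpa [hLa, lf_single, lf] using this

/-! ### Gaussian sequences: rotations and the Cameron–Martin formula -/

/-- `γ` is the law of a sequence of independent standard Gaussian variables. -/
structure IsGaussianSeq (γ : Measure (ℕ → ℝ)) : Prop where
  prob : IsProbabilityMeasure γ
  map_lf : ∀ c, γ.map (lf c) = gaussianReal 0 (nsq c).toNNReal

theorem ofReal_exp_add (a b : ℝ) : ENNReal.ofReal (Real.exp (a + b))
    = ENNReal.ofReal (Real.exp a) * ENNReal.ofReal (Real.exp b) := by
  rw [Real.exp_add, ENNReal.ofReal_mul (Real.exp_pos _).le]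

namespace IsGaussianSeq

variable {γ : Measure (ℕ → ℝ)}

theorem lintegral_exp (hγ : IsGaussianSeq γ) (c : ℕ →₀ ℝ) :
    ∫⁻ x, ENNReal.ofReal (Real.exp (lf c x)) ∂γ = ENNReal.ofReal (Real.exp (nsq c / 2)) := by
  have h1 := mgf_gaussianReal (hγ.map_lf c) 1
  have hi : Integrable (fun x => Real.exp (1 * lf c x)) γ := by
    have := integrable_exp_mul_gaussianReal (μ := 0) (v := (nsq c).toNNReal) 1
    rw [← hγ.map_lf c] at this
    exact this.comp_measurable (measurable_lf c)
  rw [mgf] at h1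
  simp only [one_mul] at h1 hi
  rw [← ofReal_integral_eq_lintegral_ofReal hi (ae_of_all _ fun _ => (Real.exp_pos _).le), h1]
  simp [nsq_nonneg]

theorem lintegral_sq (hγ : IsGaussianSeq γ) (c : ℕ →₀ ℝ) :
    ∫⁻ x, ENNReal.ofReal (lf c x ^ 2) ∂γ = ENNReal.ofReal (nsq c) := by
  have hv := variance_fun_id_gaussianReal (μ := 0) (v := (nsq c).toNNReal)
  rw [variance_of_integral_eq_zero (by fun_prop) (by simp)] at hv
  have hi : Integrable (fun x : ℝ => x ^ 2) (gaussianReal 0 (nsq c).toNNReal) :=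
    (memLp_id_gaussianReal 2).integrable_sq
  have := ofReal_integral_eq_lintegral_ofReal hi (ae_of_all _ fun _ => sq_nonneg _)
  rw [hv, ← hγ.map_lf c, lintegral_map (by fun_prop) (measurable_lf c)] at this
  rw [← this]
  simp [nsq_nonneg]

theorem eq_of_lintegral_exp (hγ : IsGaussianSeq γ) {ν : Measure (ℕ → ℝ)} [IsFiniteMeasure ν]
    (h : ∀ c, ∫⁻ x, ENNReal.ofReal (Real.exp (lf c x)) ∂ν
      = ENNReal.ofReal (Real.exp (nsq c / 2))) : ν = γ := by
  have := hγ.prob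
  exact ext_of_lintegral_exp_lf (fun c => by rw [h, hγ.lintegral_exp]) (fun c => by simp [h])

theorem map_neg (hγ : IsGaussianSeq γ) : γ.map (fun x => -x) = γ := by
  have := hγ.prob
  have hm : Measurable fun x : ℕ → ℝ => -x := measurable_neg
  have := Measure.isProbabilityMeasure_map (μ := γ) hm.aemeasurable
  refine hγ.eq_of_lintegral_exp fun c => ?_
  rw [lintegral_map (by fun_prop) hm, ← lintegral_map (f := fun x => ENNReal.ofReal (Real.exp x))
    (g := fun x => lf c (-x)) (by fun_prop) (by fun_prop)]
  have e : (fun x : ℕ → ℝ => lf c (-x)) = lf (-c) := by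
    funext x
    rw [lf_neg, ← neg_one_smul ℝ c, lf_smul_left]; ring
  rw [e, lintegral_map (by fun_prop) (by fun_prop), hγ.lintegral_exp, ← neg_one_smul ℝ c, nsq_smul]
  simp

/-- The rotation `α x + β x'` of two independent copies, `α² + β² = 1` coordinatewise. -/
theorem map_rotate (hγ : IsGaussianSeq γ) (α β : ℕ → ℝ) (h : ∀ k, α k ^ 2 + β k ^ 2 = 1) :
    (γ.prod γ).map (fun p => β * p.2 + α * p.1) = γ := by
  have := hγ.prob
  have hm : Measurable fun p : (ℕ → ℝ) × (ℕ → ℝ) => β * p.2 + α * p.1 := by fun_prop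
  have := Measure.isProbabilityMeasure_map (μ := γ.prod γ) hm.aemeasurable
  refine hγ.eq_of_lintegral_exp fun c => ?_
  rw [lintegral_map (by fun_prop) hm]
  simp_rw [lf_add, ← lf_diag, ofReal_exp_add]
  rw [lintegral_prod _ (by fun_prop)]
  simp_rw [lintegral_mul_const' _ _ ENNReal.ofReal_ne_top, hγ.lintegral_exp]
  rw [lintegral_const_mul' _ _ ENNReal.ofReal_ne_top, hγ.lintegral_exp, ← ofReal_exp_add,
    ← nsq_diag_add h c]
  congr 2
  ring

/-- The law of two independent copies is invariant under rotation by `π/4`. -/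
theorem map_rotate_pair (hγ : IsGaussianSeq γ) {r : ℝ} (hr : r ^ 2 = 1 / 2) :
    (γ.prod γ).map (fun p => (r • (p.1 + p.2), r • (p.1 - p.2))) = γ.prod γ := by
  have := hγ.prob
  have hm : Measurable fun p : (ℕ → ℝ) × (ℕ → ℝ) => (r • (p.1 + p.2), r • (p.1 - p.2)) := by
    fun_prop
  have := Measure.isProbabilityMeasure_map (μ := γ.prod γ) hm.aemeasurable
  have e : ∀ c d : ℕ →₀ ℝ, ∫⁻ p : (ℕ → ℝ) × (ℕ → ℝ), ENNReal.ofReal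
      (Real.exp (lf c p.1 + lf d p.2)) ∂(γ.prod γ)
      = ENNReal.ofReal (Real.exp (nsq c / 2 + nsq d / 2)) := by
    intro c d
    rw [lintegral_prod _ (by fun_prop)]
    simp_rw [ofReal_exp_add, lintegral_const_mul' _ _ ENNReal.ofReal_ne_top, hγ.lintegral_exp,
      lintegral_mul_const' _ _ ENNReal.ofReal_ne_top, hγ.lintegral_exp]
  have e' : ∀ c d : ℕ →₀ ℝ, ∫⁻ p : (ℕ → ℝ) × (ℕ → ℝ), ENNReal.ofReal
      (Real.exp (lf c p.1 + lf d p.2))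
        ∂((γ.prod γ).map (fun p => (r • (p.1 + p.2), r • (p.1 - p.2))))
      = ENNReal.ofReal (Real.exp (nsq c / 2 + nsq d / 2)) := by
    intro c d
    rw [lintegral_map (by fun_prop) hm]
    have : ∀ p : (ℕ → ℝ) × (ℕ → ℝ), lf c (r • (p.1 + p.2)) + lf d (r • (p.1 - p.2))
        = lf (r • (c + d)) p.1 + lf (r • (c + (-1 : ℝ) • d)) p.2 := by
      intro p
      rw [sub_eq_add_neg]
      simp only [lf_smul, lf_add, lf_smul_left, lf_add_left, lf_neg]
      ring
    simp_rw [this]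
    -- By the parallelogram identity the cross terms cancel, and `2 r² = 1` restores the norms.
    rw [e, nsq_smul, nsq_smul, nsq_add, nsq_add, nsq_smul, hr, Finsupp.coe_smul, lf_smul]
    congr 2
    ring
  exact ext_of_lintegral_exp_lf_prod (fun c d => by rw [e, e']) (fun c d => by
    rw [e']; exact ENNReal.ofReal_ne_top)

/-- The Cameron–Martin formula. -/
theorem map_add (hγ : IsGaussianSeq γ) (c : ℕ →₀ ℝ) :
    γ.map (fun x => x + (c : ℕ → ℝ))
      = γ.withDensity fun x => ENNReal.ofReal (Real.exp (lf c x - nsq c / 2)) := by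
  have := hγ.prob
  have hm : Measurable fun x : ℕ → ℝ => x + (c : ℕ → ℝ) := by fun_prop
  have := Measure.isProbabilityMeasure_map (μ := γ) hm.aemeasurable
  have e : ∀ d : ℕ →₀ ℝ, ∫⁻ x, ENNReal.ofReal (Real.exp (lf d x)) ∂(γ.withDensity fun x =>
      ENNReal.ofReal (Real.exp (lf c x - nsq c / 2)))
      = ENNReal.ofReal (Real.exp (nsq d / 2 + lf d c)) := by
    intro d
    rw [lintegral_withDensity_eq_lintegral_mul _ (by fun_prop) (by fun_prop)]
    simp_rw [Pi.mul_apply, ← ofReal_exp_add]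
    have : ∀ x : ℕ → ℝ, lf c x - nsq c / 2 + lf d x = lf (c + d) x + (- (nsq c / 2)) := by
      intro x; rw [lf_add_left]; ring
    simp_rw [this, ofReal_exp_add _ (-(nsq c / 2)),
      lintegral_mul_const' _ _ ENNReal.ofReal_ne_top, hγ.lintegral_exp, ← ofReal_exp_add]
    rw [nsq_add, lf_comm c d]
    congr 2; ring
  have hf : IsFiniteMeasure (γ.withDensity fun x =>
      ENNReal.ofReal (Real.exp (lf c x - nsq c / 2))) := by
    refine ⟨?_⟩
    have := e 0
    simp only [lf, Finsupp.sum_zero_index, Real.exp_zero, ENNReal.ofReal_one, lintegral_one] at this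
    rw [show lf c = fun x => c.sum fun k a => a * x k from rfl, this]
    exact ENNReal.ofReal_lt_top
  refine ext_of_lintegral_exp_lf (fun d => ?_) (fun d => ?_)
  all_goals
    rw [lintegral_map (by fun_prop) hm]
    simp_rw [lf_add, ofReal_exp_add, lintegral_mul_const' _ _ ENNReal.ofReal_ne_top,
      hγ.lintegral_exp, ← ofReal_exp_add]
  · rw [e]
  · exact ENNReal.ofReal_ne_top

theorem map_add_absolutelyContinuous (hγ : IsGaussianSeq γ) (c : ℕ →₀ ℝ) :
    γ.map (fun x => x + (c : ℕ → ℝ)) ≪ γ := by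
  rw [hγ.map_add]
  exact withDensity_absolutelyContinuous _ _

end IsGaussianSeq
end GMC

/-! ### Measurable functionals along contracted random shifts -/

namespace GMC

variable {T : Type*} [MeasurableSpace T]

/-- The law of `x + w(t)` under `γ ⊗ μ`. -/
noncomputable def shiftLaw (γ : Measure (ℕ → ℝ)) (μ : Measure T) (w : T → ℕ → ℝ) :
    Measure (ℕ → ℝ) :=
  (γ.prod μ).map fun p => p.1 + w p.2

variable {γ : Measure (ℕ → ℝ)} {μ : Measure T} {w : T → ℕ → ℝ}

theorem lintegral_shiftLaw [IsProbabilityMeasure μ] [IsProbabilityMeasure γ] (hw : Measurable w)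
    (hac : shiftLaw γ μ w ≪ γ) {f : (ℕ → ℝ) → ℝ≥0∞} (hf : Measurable f) :
    ∫⁻ t, ∫⁻ x, f (x + w t) ∂γ ∂μ = ∫⁻ x, (shiftLaw γ μ w).rnDeriv γ x * f x ∂γ := by
  have hm : Measurable fun p : (ℕ → ℝ) × T => p.1 + w p.2 := by fun_prop
  have : IsProbabilityMeasure (shiftLaw γ μ w) := Measure.isProbabilityMeasure_map hm.aemeasurable
  rw [← lintegral_prod_symm' (fun p : (ℕ → ℝ) × T => f (p.1 + w p.2)) (by fun_prop),
    ← lintegral_map (g := fun p : (ℕ → ℝ) × T => p.1 + w p.2) hf hm]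
  change ∫⁻ x, f x ∂(shiftLaw γ μ w) = _
  conv_lhs => rw [← Measure.withDensity_rnDeriv_eq _ _ hac]
  rw [lintegral_withDensity_eq_lintegral_mul _ (Measure.measurable_rnDeriv _ _) hf]
  rfl

/-- The laws of the contracted shifts `x + α w(t)`, `0 ≤ α ≤ 1`, are absolutely continuous with
respect to `γ` uniformly in `α`. -/
theorem lintegral_shift_le [IsProbabilityMeasure μ] (hγ : IsGaussianSeq γ) (hw : Measurable w)
    (hac : shiftLaw γ μ w ≪ γ) {f : (ℕ → ℝ) → ℝ≥0∞} (hf : Measurable f) {C : ℝ≥0∞}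
    (hC : ∀ x, f x ≤ C) (N : ℝ≥0∞) {α : ℕ → ℝ} (hα : ∀ k, α k ∈ Set.Icc (0 : ℝ) 1) :
    ∫⁻ p, f (p.1 + α * w p.2) ∂(γ.prod μ) ≤ N * ∫⁻ x, f x ∂γ
      + (∫⁻ x in {x | N < (shiftLaw γ μ w).rnDeriv γ x}, (shiftLaw γ μ w).rnDeriv γ x ∂γ) * C := by
  have := hγ.prob
  set D := (shiftLaw γ μ w).rnDeriv γ with hD
  have hDm : Measurable D := Measure.measurable_rnDeriv _ _
  have hs : MeasurableSet {x | N < D x} := measurableSet_lt measurable_const hDm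
  -- With this `β`, `x + α w` has the law of `β x' + α (x + w)`. For fixed `x'` the inner variable
  -- `x + w` has density `D` with respect to `γ`, whatever `α` is; this is the source of uniformity.
  let β : ℕ → ℝ := fun k => √(1 - α k ^ 2)
  have hβ : ∀ k, α k ^ 2 + β k ^ 2 = 1 := fun k => by
    have h1 := hα k
    have : 0 ≤ 1 - α k ^ 2 := by nlinarith [h1.1, h1.2]
    simp only [β, Real.sq_sqrt this]
    ring
  have rot : ∀ g : (ℕ → ℝ) → ℝ≥0∞, Measurable g →
      ∫⁻ x, g x ∂γ = ∫⁻ x', ∫⁻ x, g (β * x' + α * x) ∂γ ∂γ := by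
    intro g hg
    conv_lhs => rw [← hγ.map_rotate α β hβ]
    rw [lintegral_map hg (by fun_prop), lintegral_prod_symm' _ (by fun_prop)]
  calc ∫⁻ p, f (p.1 + α * w p.2) ∂(γ.prod μ)
      = ∫⁻ t, ∫⁻ x, f (x + α * w t) ∂γ ∂μ := lintegral_prod_symm' _ (by fun_prop)
    _ = ∫⁻ t, ∫⁻ x', ∫⁻ x, f (β * x' + α * (x + w t)) ∂γ ∂γ ∂μ := by
        refine lintegral_congr fun t => ?_
        rw [rot _ (by fun_prop)]
        simp_rw [mul_add, add_assoc]
    _ = ∫⁻ x', ∫⁻ t, ∫⁻ x, f (β * x' + α * (x + w t)) ∂γ ∂μ ∂γ :=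
        lintegral_lintegral_swap (Measurable.lintegral_prod_right' (ν := γ)
          (f := fun q : (T × (ℕ → ℝ)) × (ℕ → ℝ) => f (β * q.1.2 + α * (q.2 + w q.1.1)))
          (by fun_prop)).aemeasurable
    _ = ∫⁻ x', ∫⁻ x, D x * f (β * x' + α * x) ∂γ ∂γ := by
        refine lintegral_congr fun x' => ?_
        exact lintegral_shiftLaw hw hac (f := fun y => f (β * x' + α * y)) (by fun_prop)
    _ ≤ ∫⁻ x', ∫⁻ x, (N * f (β * x' + α * x) + {x | N < D x}.indicator D x * C) ∂γ ∂γ := by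
        refine lintegral_mono fun x' => lintegral_mono fun x => ?_
        -- Where `D ≤ N` the density costs a factor `N`; elsewhere `f ≤ C` and only the tail of `D`
        -- is paid.
        by_cases hx : N < D x
        · rw [Set.indicator_of_mem (by exact hx)]
          exact (mul_le_mul_right (hC _) _).trans le_add_self
        · exact (mul_le_mul_left (not_lt.1 hx) _).trans le_self_add
    _ = _ := by
        rw [rot f hf]
        simp_rw [lintegral_add_right _ ((hDm.indicator hs).mul_const C)]
        rw [lintegral_add_right _ measurable_const, lintegral_const, measure_univ, mul_one,
          lintegral_mul_const _ (hDm.indicator hs), lintegral_indicator hs,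
          ← lintegral_const_mul _ (Measurable.lintegral_prod_right' (ν := γ)
            (f := fun q : (ℕ → ℝ) × (ℕ → ℝ) => f (β * q.1 + α * q.2)) (by fun_prop))]
        congr 1
        refine lintegral_congr fun x' => ?_
        rw [lintegral_const_mul _ (by fun_prop)]

/-- The density is integrable, so its tails vanish; this makes the error term of
`lintegral_shift_le` small. -/
theorem tendsto_tail_rnDeriv [IsProbabilityMeasure μ] [IsProbabilityMeasure γ] (hw : Measurable w) :
    Tendsto (fun N : ℕ => ∫⁻ x in {x | (N : ℝ≥0∞) < (shiftLaw γ μ w).rnDeriv γ x},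
      (shiftLaw γ μ w).rnDeriv γ x ∂γ) atTop (𝓝 0) := by
  set D := (shiftLaw γ μ w).rnDeriv γ with hD
  have hDm : Measurable D := Measure.measurable_rnDeriv _ _
  have hm : Measurable fun p : (ℕ → ℝ) × T => p.1 + w p.2 := by fun_prop
  have : IsProbabilityMeasure (shiftLaw γ μ w) := Measure.isProbabilityMeasure_map hm.aemeasurable
  have hfin : ∫⁻ x, D x ∂γ ≠ ∞ := (Measure.lintegral_rnDeriv_lt_top _ _).ne
  have hs : ∀ N : ℕ, MeasurableSet {x | (N : ℝ≥0∞) < D x} :=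
    fun N => measurableSet_lt measurable_const hDm
  simp_rw [← lintegral_indicator (hs _)]
  rw [show (0 : ℝ≥0∞) = ∫⁻ x, (0 : ℝ≥0∞) ∂γ by simp]
  refine tendsto_lintegral_of_dominated_convergence D (fun N => hDm.indicator (hs N))
    (fun N => ae_of_all _ fun x => Set.indicator_le_self _ _ _) hfin ?_
  filter_upwards [ae_lt_top hDm hfin] with x hx
  obtain ⟨n, hn⟩ := ENNReal.exists_nat_gt hx.ne
  refine tendsto_const_nhds.congr' ?_
  filter_upwards [eventually_ge_atTop n] with N hN
  rw [Set.indicator_of_notMem]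
  simp only [Set.mem_ofPred_eq, not_lt]
  exact hn.le.trans (by exact_mod_cast hN)

/-- Measurable functionals are continuous in mean along converging contracted shifts. -/
theorem tendsto_lintegral_shift_sub [IsProbabilityMeasure μ] (hγ : IsGaussianSeq γ)
    (hw : Measurable w) (hac : shiftLaw γ μ w ≪ γ) {F : (ℕ → ℝ) → ℝ} (hF : Measurable F)
    {C : ℝ} (hC : ∀ x, |F x| ≤ C) {α : ℕ → ℕ → ℝ} {a : ℕ → ℝ}
    (hα : ∀ j k, α j k ∈ Set.Icc (0 : ℝ) 1) (ha : ∀ k, a k ∈ Set.Icc (0 : ℝ) 1)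
    (hlim : ∀ k, Tendsto (fun j => α j k) atTop (𝓝 (a k))) :
    Tendsto (fun j => ∫⁻ p, ‖F (p.1 + α j * w p.2) - F (p.1 + a * w p.2)‖ₑ ∂(γ.prod μ))
      atTop (𝓝 0) := by
  have := hγ.prob
  have hC0 : 0 ≤ C := (abs_nonneg _).trans (hC 0)
  have hm : ∀ b : ℕ → ℝ, Measurable fun p : (ℕ → ℝ) × T => p.1 + b * w p.2 := by
    intro b; fun_prop
  rw [ENNReal.tendsto_nhds_zero]
  intro ε hε
  by_cases hεt : ε = ∞
  · simp [hεt]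
  -- The factor five is `2 + 1 + 2`: two approximation errors of `2 η` each, and one `η` for the
  -- continuous functional.
  obtain ⟨η, hη0, hη⟩ : ∃ η : ℝ≥0∞, 0 < η ∧ 5 * η ≤ ε :=
    ⟨ε / 5, ENNReal.div_pos hε.ne' (by simp), by rw [ENNReal.mul_div_cancel (by simp) (by simp)]⟩
  -- choose the truncation level, then the approximating continuous function
  have h2C : ENNReal.ofReal (2 * C) ≠ ∞ := ENNReal.ofReal_ne_top
  obtain ⟨N, hN⟩ : ∃ N : ℕ, (∫⁻ x in {x | (N : ℝ≥0∞) < (shiftLaw γ μ w).rnDeriv γ x},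
      (shiftLaw γ μ w).rnDeriv γ x ∂γ) * ENNReal.ofReal (2 * C) ≤ η := by
    have := ENNReal.Tendsto.mul_const (tendsto_tail_rnDeriv (γ := γ) (μ := μ) hw)
      (Or.inr h2C)
    rw [zero_mul] at this
    exact ((ENNReal.tendsto_nhds_zero.1 this) η hη0).exists
  have hFi : Integrable F γ := Integrable.of_bound hF.aestronglyMeasurable C
    (ae_of_all _ fun x => by simpa using hC x)
  obtain ⟨δ, hδ0, hδ⟩ : ∃ δ : ℝ≥0∞, 0 < δ ∧ N * δ ≤ η := by
    -- Dividing by `N + 1` covers `N = 0`.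
    refine ⟨η / (N + 1), ENNReal.div_pos hη0.ne' (by finiteness), ?_⟩
    rw [← mul_div_assoc]
    refine ENNReal.div_le_of_le_mul ?_
    rw [mul_comm]
    gcongr
    exact le_self_add
  obtain ⟨G, hG, -⟩ := hFi.exists_boundedContinuous_lintegral_sub_le hδ0.ne'
  -- Clipping to `[-C, C]` keeps continuity, gives the bound required by `lintegral_shift_le`, and
  -- does not increase the distance to `F`.
  let g : (ℕ → ℝ) → ℝ := fun x => max (-C) (min C (G x))
  have hgc : Continuous g := by fun_prop
  have hgb : ∀ x, |g x| ≤ C := fun x => abs_le.2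
    ⟨le_max_left _ _, max_le (by linarith) (min_le_left _ _)⟩
  have hFg : ∀ x, |F x - g x| ≤ |F x - G x| := by
    intro x
    have h1 := abs_le.1 (hC x)
    have : F x = max (-C) (min C (F x)) := by rw [min_eq_right h1.2, max_eq_right h1.1]
    conv_lhs => rw [this]
    refine (abs_max_sub_max_le_max _ _ _ _).trans ?_
    rw [sub_self, abs_zero, max_eq_right (abs_nonneg _)]
    refine (abs_min_sub_min_le_max _ _ _ _).trans ?_
    rw [sub_self, abs_zero, max_eq_right (abs_nonneg _)]
  have herr : ∀ b : ℕ → ℝ, (∀ k, b k ∈ Set.Icc (0 : ℝ) 1) →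
      ∫⁻ p, ‖F (p.1 + b * w p.2) - g (p.1 + b * w p.2)‖ₑ ∂(γ.prod μ) ≤ 2 * η := by
    intro b hb
    have h1 := lintegral_shift_le hγ hw hac (f := fun x => ‖F x - g x‖ₑ) (by fun_prop)
      (C := ENNReal.ofReal (2 * C)) (fun x => by
        rw [← ofReal_norm, Real.norm_eq_abs]
        refine ENNReal.ofReal_le_ofReal ((abs_sub _ _).trans ?_)
        linarith [hC x, hgb x]) N hb
    refine h1.trans ?_
    rw [two_mul η]
    refine add_le_add (le_trans ?_ hδ) hN
    gcongr
    refine le_trans (lintegral_mono fun x => ?_) hG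
    rw [← ofReal_norm, ← ofReal_norm]
    exact ENNReal.ofReal_le_ofReal (hFg x)
  have hmid : Tendsto (fun j => ∫⁻ p, ‖g (p.1 + α j * w p.2) - g (p.1 + a * w p.2)‖ₑ ∂(γ.prod μ))
      atTop (𝓝 0) := by
    rw [show (0 : ℝ≥0∞) = ∫⁻ p, (0 : ℝ≥0∞) ∂(γ.prod μ) by simp]
    refine tendsto_lintegral_of_dominated_convergence (fun _ => ENNReal.ofReal (2 * C))
      (fun j => by fun_prop) (fun j => ae_of_all _ fun p => ?_) (by rw [lintegral_const, measure_univ, mul_one]; exact h2C) (ae_of_all _ fun p => ?_)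
    · change ‖g (p.1 + α j * w p.2) - g (p.1 + a * w p.2)‖ₑ ≤ ENNReal.ofReal (2 * C)
      rw [← ofReal_norm, Real.norm_eq_abs]
      refine ENNReal.ofReal_le_ofReal ((abs_sub _ _).trans ?_)
      linarith [hgb (p.1 + α j * w p.2), hgb (p.1 + a * w p.2)]
    · have h1 : Tendsto (fun j => p.1 + α j * w p.2) atTop (𝓝 (p.1 + a * w p.2)) := by
        rw [tendsto_pi_nhds]
        exact fun k => ((hlim k).mul_const _).const_add _
      have h2 := ((hgc.tendsto _).comp h1).sub_const (g (p.1 + a * w p.2))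
      rw [sub_self] at h2
      simpa using h2.enorm
  filter_upwards [(ENNReal.tendsto_nhds_zero.1 hmid) η hη0] with j hj
  calc ∫⁻ p, ‖F (p.1 + α j * w p.2) - F (p.1 + a * w p.2)‖ₑ ∂(γ.prod μ)
      ≤ ∫⁻ p, (‖F (p.1 + α j * w p.2) - g (p.1 + α j * w p.2)‖ₑ
        + ‖g (p.1 + α j * w p.2) - g (p.1 + a * w p.2)‖ₑ
        + ‖F (p.1 + a * w p.2) - g (p.1 + a * w p.2)‖ₑ) ∂(γ.prod μ) := by
        refine lintegral_mono fun p => ?_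
        rw [← enorm_neg (F (p.1 + a * w p.2) - g (p.1 + a * w p.2))]
        refine le_trans (le_of_eq ?_) ((enorm_add_le _ _).trans
          (add_le_add_left (enorm_add_le _ _) _))
        congr 1
        ring
    _ ≤ 2 * η + η + 2 * η := by
        rw [lintegral_add_right _ (by fun_prop), lintegral_add_right _ (by fun_prop)]
        exact add_le_add (add_le_add (herr _ (hα j)) hj) (herr _ ha)
    _ = 5 * η := by ring
    _ ≤ ε := hη

/-- Along a subsequence, measurable functionals converge a.e. along converging contracted
shifts. -/
theorem exists_seq_tendsto_shift [IsProbabilityMeasure μ] (hγ : IsGaussianSeq γ)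
    (hw : Measurable w) (hac : shiftLaw γ μ w ≪ γ) {F : (ℕ → ℝ) → ℝ} (hF : Measurable F)
    {α : ℕ → ℕ → ℝ} {a : ℕ → ℝ}
    (hα : ∀ j k, α j k ∈ Set.Icc (0 : ℝ) 1) (ha : ∀ k, a k ∈ Set.Icc (0 : ℝ) 1)
    (hlim : ∀ k, Tendsto (fun j => α j k) atTop (𝓝 (a k))) :
    ∃ ns : ℕ → ℕ, StrictMono ns ∧ ∀ᵐ p ∂(γ.prod μ),
      Tendsto (fun j => F (p.1 + α (ns j) * w p.2)) atTop (𝓝 (F (p.1 + a * w p.2))) := by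
  -- The arctangent makes `F` bounded; the tangent undoes it at the end, being continuous on the
  -- range of `arctan`.
  have h := tendsto_lintegral_shift_sub hγ hw hac (F := fun x => Real.arctan (F x))
    (Real.measurable_arctan.comp hF) (C := Real.pi / 2)
    (fun x => abs_le.2 ⟨(Real.neg_pi_div_two_lt_arctan _).le, (Real.arctan_lt_pi_div_two _).le⟩)
    hα ha hlim
  have hmeas : ∀ b : ℕ → ℝ, Measurable fun p : (ℕ → ℝ) × T => Real.arctan (F (p.1 + b * w p.2)) := by
    intro b
    exact Real.measurable_arctan.comp (hF.comp (by fun_prop))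
  have h1 : TendstoInMeasure (γ.prod μ) (fun j p => Real.arctan (F (p.1 + α j * w p.2))) atTop
      fun p => Real.arctan (F (p.1 + a * w p.2)) := by
    refine tendstoInMeasure_of_tendsto_eLpNorm one_ne_zero
      (fun j => (hmeas _).aestronglyMeasurable) (hmeas _).aestronglyMeasurable ?_
    simpa only [eLpNorm_one_eq_lintegral_enorm, Pi.sub_apply] using h
  obtain ⟨ns, hns, h2⟩ := h1.exists_seq_tendsto_ae
  refine ⟨ns, hns, ?_⟩
  filter_upwards [h2] with p hp
  have hc : ContinuousAt Real.tan (Real.arctan (F (p.1 + a * w p.2))) :=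
    Real.continuousAt_tan.2 (Real.cos_arctan_pos _).ne'
  simpa [Function.comp_def, Real.tan_arctan] using hc.tendsto.comp hp

end GMC

/-! ### Chaos in coordinates and the Peyrière formula -/

namespace GMC

variable {T : Type*} [MeasurableSpace T]

/-- A kernel all of whose values are finite measures is s-finite. -/
theorem isSFiniteKernel_of_isFiniteMeasure {E : Type*} [MeasurableSpace E] (M : Kernel E T)
    (h : ∀ x, IsFiniteMeasure (M x)) : IsSFiniteKernel M := by
  classical
  have hm : Measurable fun x => M x Set.univ := M.measurable_coe MeasurableSet.univ
  have hs : ∀ n : ℕ, MeasurableSet {x | ⌊(M x Set.univ).toReal⌋₊ = n} := fun n =>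
    (Nat.measurable_floor.comp hm.ennreal_toReal) (measurableSet_singleton n)
  -- Slicing by the integer part of the total mass: slice `n` has mass at most `n + 1`.
  let κ : ℕ → Kernel E T := fun n => Kernel.piecewise (hs n) M 0
  have hκ : ∀ n, IsFiniteKernel (κ n) := fun n => by
    refine ⟨⟨(n + 1 : ℕ), ENNReal.natCast_lt_top _, fun x => ?_⟩⟩
    simp only [κ, Kernel.piecewise_apply]
    split_ifs with hx
    · have h1 := Nat.lt_floor_add_one (M x Set.univ).toReal
      rw [show ⌊(M x Set.univ).toReal⌋₊ = n from hx] at h1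
      rw [← ENNReal.ofReal_toReal (measure_ne_top (M x) Set.univ), ← ENNReal.ofReal_natCast]
      exact ENNReal.ofReal_le_ofReal (by exact_mod_cast h1.le)
    · simp
  refine ⟨⟨κ, hκ, ?_⟩⟩
  ext x s hs'
  rw [Kernel.sum_apply' _ _ hs', tsum_eq_single ⌊(M x Set.univ).toReal⌋₊]
  · simp [κ, Kernel.piecewise_apply]
  · intro n hn
    simp [κ, Kernel.piecewise_apply, hn.symm]

/-- The chaos `M` over `z`, as a kernel on the law `γ` of the Gaussian, with mean `μ`. -/
structure IsChaos (γ : Measure (ℕ → ℝ)) (μ : Measure T) (z : T → ℕ → ℝ)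
    (M : Kernel (ℕ → ℝ) T) : Prop where
  finite : ∀ x, IsFiniteMeasure (M x)
  mean : γ.bind M = μ
  shift : ∀ c : ℕ →₀ ℝ, ∀ᵐ x ∂γ, M (x + (c : ℕ → ℝ))
    = (M x).withDensity fun t => ENNReal.ofReal (Real.exp (lf c (z t)))

variable {γ : Measure (ℕ → ℝ)} {μ : Measure T} {z : T → ℕ → ℝ} {M : Kernel (ℕ → ℝ) T}

namespace IsChaos

theorem isSFiniteKernel (hM : IsChaos γ μ z M) : IsSFiniteKernel M :=
  isSFiniteKernel_of_isFiniteMeasure M hM.finite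

theorem lintegral_lintegral (hM : IsChaos γ μ z M) {f : T → ℝ≥0∞} (hf : Measurable f) :
    ∫⁻ x, ∫⁻ t, f t ∂(M x) ∂γ = ∫⁻ t, f t ∂μ := by
  rw [← hM.mean, Measure.lintegral_bind M.measurable.aemeasurable hf.aemeasurable]

theorem lintegral_apply (hM : IsChaos γ μ z M) {A : Set T} (hA : MeasurableSet A) :
    ∫⁻ x, M x A ∂γ = μ A := by
  rw [← hM.mean, Measure.bind_apply hA M.measurable.aemeasurable]

theorem ae_ae (hM : IsChaos γ μ z M) {p : T → Prop} (hp : ∀ᵐ t ∂μ, p t) :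
    ∀ᵐ x ∂γ, ∀ᵐ t ∂(M x), p t := by
  rw [← hM.mean] at hp
  exact Measure.ae_ae_of_ae_bind M.measurable.aemeasurable hp

/-- The Peyrière formula: under `M(x, dt) γ(dx)`, `x` is distributed like `x + z(t)` under
`γ ⊗ μ`. -/
theorem compProd_eq [IsProbabilityMeasure μ] (hM : IsChaos γ μ z M) (hγ : IsGaussianSeq γ)
    (hz : Measurable z) : γ ⊗ₘ M = (γ.prod μ).map fun p => (p.1 + z p.2, p.2) := by
  have := hM.isSFiniteKernel
  have := hγ.prob
  have hm : Measurable fun p : (ℕ → ℝ) × T => (p.1 + z p.2, p.2) := by fun_prop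
  have hm1 : Measurable fun p : (ℕ → ℝ) × T => p.1 + z p.2 := by fun_prop
  -- the formula on sets of `t` where `z` is in a compact set
  have key : ∀ (B : Set (ℕ → ℝ)) (A : Set T) (C : Set (ℕ → ℝ)), MeasurableSet B →
      MeasurableSet A → IsCompact C → A ⊆ z ⁻¹' C →
      (γ ⊗ₘ M) (B ×ˢ A) = ((γ.prod μ).map fun p => (p.1 + z p.2, p.2)) (B ×ˢ A) := by
    intro B A C hB hA hC hAC
    -- With `A` fixed, both sides are measures in `B`, to be compared through their exponential
    -- moments.
    let ν₁ := γ.withDensity fun x => M x A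
    let ν₂ := (γ.prod (μ.restrict A)).map fun p => p.1 + z p.2
    have hMA : Measurable fun x => M x A := M.measurable_coe hA
    have e₁ : ∀ c, ∫⁻ x, ENNReal.ofReal (Real.exp (lf c x)) ∂ν₁
        = ENNReal.ofReal (Real.exp (nsq c / 2)) *
          ∫⁻ t in A, ENNReal.ofReal (Real.exp (lf c (z t))) ∂μ := by
      intro c
      rw [lintegral_withDensity_eq_lintegral_mul _ hMA (by fun_prop)]
      -- Cameron–Martin trades the weight `exp (lf c x)` for the shift `x + c`; the shift property
      -- then moves the exponential inside `M`, and the mean of `M` is `μ`.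
      calc ∫⁻ x, M x A * ENNReal.ofReal (Real.exp (lf c x)) ∂γ
          = ∫⁻ x, ENNReal.ofReal (Real.exp (nsq c / 2)) *
              (ENNReal.ofReal (Real.exp (lf c x - nsq c / 2)) * M x A) ∂γ := by
            refine lintegral_congr fun x => ?_
            rw [← mul_assoc, ← ofReal_exp_add, mul_comm]
            congr 3
            ring
        _ = ENNReal.ofReal (Real.exp (nsq c / 2)) * ∫⁻ x, M (x + (c : ℕ → ℝ)) A ∂γ := by
            rw [lintegral_const_mul' _ _ ENNReal.ofReal_ne_top]
            congr 1
            rw [← lintegral_map (g := fun x => x + (c : ℕ → ℝ)) hMA (by fun_prop), hγ.map_add,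
              lintegral_withDensity_eq_lintegral_mul _ (by fun_prop) hMA]
            rfl
        _ = _ := by
            congr 1
            rw [← lintegral_indicator hA, ← hM.lintegral_lintegral
              (Measurable.indicator (by fun_prop) hA)]
            refine lintegral_congr_ae ?_
            filter_upwards [hM.shift c] with x hx
            rw [hx, withDensity_apply _ hA, lintegral_indicator hA]
    have e₂ : ∀ c, ∫⁻ x, ENNReal.ofReal (Real.exp (lf c x)) ∂ν₂
        = ENNReal.ofReal (Real.exp (nsq c / 2)) *
          ∫⁻ t in A, ENNReal.ofReal (Real.exp (lf c (z t))) ∂μ := by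
      intro c
      rw [lintegral_map (by fun_prop) hm1, lintegral_prod_symm' _ (by fun_prop)]
      simp_rw [lf_add, ofReal_exp_add, lintegral_mul_const' _ _ ENNReal.ofReal_ne_top,
        hγ.lintegral_exp]
      rw [lintegral_const_mul' _ _ ENNReal.ofReal_ne_top]
    -- Here compactness enters: `lf c` is bounded on `C`, whereas `exp (lf c (z t))` need not be
    -- `μ`-integrable over all of `T`.
    have hf : ∀ c, ∫⁻ x, ENNReal.ofReal (Real.exp (lf c x)) ∂ν₁ ≠ ∞ := by
      intro c
      rw [e₁]
      refine ENNReal.mul_ne_top ENNReal.ofReal_ne_top ?_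
      obtain ⟨R, hR⟩ := hC.bddAbove_image (continuous_lf c).continuousOn
      refine ne_top_of_le_ne_top (b := ∫⁻ t in A, ENNReal.ofReal (Real.exp R) ∂μ) ?_ ?_
      · rw [setLIntegral_const]
        exact ENNReal.mul_ne_top ENNReal.ofReal_ne_top (measure_ne_top _ _)
      · refine setLIntegral_mono' hA fun t ht => ?_
        gcongr
        exact hR ⟨z t, hAC ht, rfl⟩
    have : IsFiniteMeasure ν₁ := ⟨by
      rw [withDensity_apply _ MeasurableSet.univ, Measure.restrict_univ, hM.lintegral_apply hA]
      exact measure_lt_top _ _⟩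
    have : IsFiniteMeasure ν₂ := Measure.isFiniteMeasure_map _ _
    have hν : ν₁ = ν₂ := ext_of_lintegral_exp_lf (fun c => by rw [e₁, e₂]) hf
    rw [Measure.compProd_apply_prod hB hA, ← withDensity_apply _ hB]
    change ν₁ B = _
    rw [hν, Measure.map_apply hm1 hB, Measure.map_apply hm (hB.prod hA)]
    rw [← Measure.restrict_univ (μ := γ), Measure.prod_restrict,
      Measure.restrict_apply (hm1 hB), Measure.restrict_univ]
    congr 1
    ext p
    simp
  have hsnd : ∀ G : Set T, MeasurableSet G → (γ ⊗ₘ M) (Set.univ ×ˢ G) = μ G ∧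
      ((γ.prod μ).map fun p => (p.1 + z p.2, p.2)) (Set.univ ×ˢ G) = μ G := by
    intro G hG
    constructor
    · rw [Measure.compProd_apply_prod MeasurableSet.univ hG, Measure.restrict_univ,
        hM.lintegral_apply hG]
    · rw [Measure.map_apply hm (MeasurableSet.univ.prod hG)]
      have : (fun p : (ℕ → ℝ) × T => (p.1 + z p.2, p.2)) ⁻¹' Set.univ ×ˢ G = Set.univ ×ˢ G := by
        ext p; simp
      rw [this, Measure.prod_prod, measure_univ, one_mul]
  have hfin : IsFiniteMeasure (γ ⊗ₘ M) := ⟨by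
    rw [← Set.univ_prod_univ, (hsnd _ MeasurableSet.univ).1]; exact measure_lt_top _ _⟩
  refine Measure.ext_prod fun {B A} hB hA => ?_
  have hz' := Measure.isProbabilityMeasure_map (μ := μ) hz.aemeasurable
  -- Both measures have `μ` as second marginal, so discarding `t ∉ G` costs at most `μ Gᶜ`.
  have split : ∀ (Q Q' : Measure ((ℕ → ℝ) × T)) (G : Set T), MeasurableSet G →
      Q (B ×ˢ (A ∩ G)) = Q' (B ×ˢ (A ∩ G)) → Q (Set.univ ×ˢ Gᶜ) = μ Gᶜ →
      Q (B ×ˢ A) ≤ Q' (B ×ˢ A) + μ Gᶜ := by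
    intro Q Q' G hG h h'
    calc Q (B ×ˢ A) ≤ Q (B ×ˢ (A ∩ G) ∪ Set.univ ×ˢ Gᶜ) := measure_mono fun p hp => by
          by_cases hpG : p.2 ∈ G
          · exact Or.inl ⟨hp.1, hp.2, hpG⟩
          · exact Or.inr ⟨trivial, hpG⟩
      _ ≤ Q (B ×ˢ (A ∩ G)) + Q (Set.univ ×ˢ Gᶜ) := measure_union_le _ _
      _ ≤ Q' (B ×ˢ A) + μ Gᶜ := by
          rw [h, h']
          gcongr
          exact Set.inter_subset_left
  have main : ∀ ε : ℝ≥0∞, 0 < ε → ∃ G : Set T, MeasurableSet G ∧ μ Gᶜ ≤ ε ∧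
      (γ ⊗ₘ M) (B ×ˢ (A ∩ G)) = ((γ.prod μ).map fun p => (p.1 + z p.2, p.2)) (B ×ˢ (A ∩ G)) := by
    intro ε hε
    -- The law of `z` on the Polish space `ℝ^∞` is tight, so compact values exhaust `μ` up to `ε`.
    obtain ⟨C, hC, h⟩ := isTightMeasureSet_iff_exists_isCompact_measure_compl_le.1
      (isTightMeasureSet_singleton (μ := μ.map z)) ε hε
    have h1 := h _ rfl
    rw [Measure.map_apply hz hC.measurableSet.compl] at h1
    exact ⟨z ⁻¹' C, hz hC.measurableSet, h1, key _ _ C hB (hA.inter (hz hC.measurableSet)) hC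
      Set.inter_subset_right⟩
  refine le_antisymm (ENNReal.le_of_forall_pos_le_add fun ε hε _ => ?_)
    (ENNReal.le_of_forall_pos_le_add fun ε hε _ => ?_)
  all_goals
    obtain ⟨G, hG, hμ, h⟩ := main ε (by exact_mod_cast hε)
  · exact (split _ _ G hG h (hsnd _ hG.compl).1).trans (by gcongr)
  · exact (split _ _ G hG h.symm (hsnd _ hG.compl).2).trans (by gcongr)

theorem lintegral_peyriere [IsProbabilityMeasure μ] (hM : IsChaos γ μ z M) (hγ : IsGaussianSeq γ)
    (hz : Measurable z) {F : (ℕ → ℝ) × T → ℝ≥0∞} (hF : Measurable F) :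
    ∫⁻ x, ∫⁻ t, F (x, t) ∂(M x) ∂γ = ∫⁻ p, F (p.1 + z p.2, p.2) ∂(γ.prod μ) := by
  have := hM.isSFiniteKernel
  have := hγ.prob
  rw [← Measure.lintegral_compProd hF, hM.compProd_eq hγ hz, lintegral_map hF (by fun_prop)]

end IsChaos

/-- Two families of finite measures that agree a.e. on each measurable set agree a.e. -/
theorem ae_eq_of_forall_measurableSet [StandardBorelSpace T] {S : Type*} [MeasurableSpace S]
    {ρ : Measure S} {κ η : S → Measure T} (hfin : ∀ᵐ p ∂ρ, IsFiniteMeasure (κ p))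
    (h : ∀ A, MeasurableSet A → ∀ᵐ p ∂ρ, κ p A = η p A) : ∀ᵐ p ∂ρ, κ p = η p := by
  have he := measurableEmbedding_embeddingReal T
  -- After embedding `T` in `ℝ`, rational half-lines form a countable determining π-system, so one
  -- null set serves for all of them.
  have h1 : ∀ᵐ p ∂ρ, ∀ q : ℚ, κ p (embeddingReal T ⁻¹' Set.Iic (q : ℝ))
      = η p (embeddingReal T ⁻¹' Set.Iic (q : ℝ)) :=
    ae_all_iff.2 fun q => h _ (he.measurable measurableSet_Iic)
  filter_upwards [hfin, h1, h _ MeasurableSet.univ] with p hp hq hu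
  have : (κ p).map (embeddingReal T) = (η p).map (embeddingReal T) := by
    have := Measure.isFiniteMeasure_map (κ p) (embeddingReal T)
    refine ext_of_generate_finite (⋃ a : ℚ, {Set.Iic (a : ℝ)})
      ((BorelSpace.measurable_eq (α := ℝ)).trans Real.borel_eq_generateFrom_Iic_rat)
      Real.isPiSystem_Iic_rat ?_ ?_
    · intro s hs
      simp only [Set.mem_iUnion, Set.mem_singleton_iff] at hs
      obtain ⟨q, rfl⟩ := hs
      rw [Measure.map_apply he.measurable measurableSet_Iic,
        Measure.map_apply he.measurable measurableSet_Iic, hq]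
    · simpa [Measure.map_apply he.measurable MeasurableSet.univ] using hu
  rw [← he.comap_map (κ p), this, he.comap_map]

end GMC

/-! ### Shifting a chaos by a randomized shift -/

namespace GMC

variable {T : Type*} [MeasurableSpace T]

/-- The partial sums `∑_{k < n} xₖ yₖ`. -/
noncomputable def kerSum (n : ℕ) (x y : ℕ → ℝ) : ℝ := ∑ k ∈ Finset.range n, x k * y k

/-- The multiplier `θ · 1_{k < n}`. -/
noncomputable def cut (θ : ℝ) (n : ℕ) : ℕ → ℝ := fun k => if k < n then θ else 0

/-- The finitely supported sequence `θ yₖ 1_{k < n}`. -/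
noncomputable def trunc (θ : ℝ) (n : ℕ) (y : ℕ → ℝ) : ℕ →₀ ℝ :=
  Finsupp.onFinset (Finset.range n) (cut θ n * y) fun k hk => by
    by_contra h
    exact hk (by simp [cut, show ¬ k < n by simpa using h])

theorem coe_trunc (θ : ℝ) (n : ℕ) (y : ℕ → ℝ) : (trunc θ n y : ℕ → ℝ) = cut θ n * y := rfl

theorem lf_trunc (θ : ℝ) (n : ℕ) (x y : ℕ → ℝ) : lf (trunc θ n y) x = θ * kerSum n x y := by
  unfold lf trunc kerSum
  rw [Finsupp.onFinset_sum _ (by simp), Finset.mul_sum]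
  refine Finset.sum_congr rfl fun k hk => ?_
  simp only [Pi.mul_apply, cut, if_pos (Finset.mem_range.1 hk)]
  ring

theorem cut_mem_Icc {θ : ℝ} (h : θ ∈ Set.Icc (0 : ℝ) 1) (n k : ℕ) :
    cut θ n k ∈ Set.Icc (0 : ℝ) 1 := by
  unfold cut
  split_ifs
  · exact h
  · simp

theorem tendsto_cut (θ : ℝ) (k : ℕ) : Tendsto (fun n => cut θ n k) atTop (𝓝 θ) := by
  refine tendsto_const_nhds.congr' ?_
  filter_upwards [eventually_gt_atTop k] with n hn
  simp [cut, hn]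

@[fun_prop]
theorem measurable_kerSum {S : Type*} [MeasurableSpace S] (n : ℕ) {f g : S → ℕ → ℝ}
    (hf : Measurable f) (hg : Measurable g) : Measurable fun s => kerSum n (f s) (g s) := by
  unfold kerSum
  fun_prop

/-- If `∫ exp fₙ` is bounded and `fₙ → f` a.e., then `∫ exp (θ fₙ) → ∫ exp (θ f)` for
`0 < θ < 1`. -/
theorem tendsto_lintegral_exp_mul (m : Measure T) [IsFiniteMeasure m] {f : ℕ → T → ℝ} {g : T → ℝ}
    (hf : ∀ n, Measurable (f n)) (hlim : ∀ᵐ t ∂m, Tendsto (fun n => f n t) atTop (𝓝 (g t)))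
    {C : ℝ≥0∞} (hC : C ≠ ∞) (hb : ∀ᶠ n in atTop, ∫⁻ t, ENNReal.ofReal (Real.exp (f n t)) ∂m ≤ C)
    {θ : ℝ} (h0 : 0 < θ) (h1 : θ < 1) :
    Tendsto (fun n => ∫⁻ t, ENNReal.ofReal (Real.exp (θ * f n t)) ∂m) atTop
      (𝓝 (∫⁻ t, ENNReal.ofReal (Real.exp (θ * g t)) ∂m)) := by
  have hlim' : ∀ᵐ t ∂m, Tendsto (fun n => ENNReal.ofReal (Real.exp (θ * f n t))) atTop
      (𝓝 (ENNReal.ofReal (Real.exp (θ * g t)))) := by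
    filter_upwards [hlim] with t ht
    exact ENNReal.tendsto_ofReal ((Real.continuous_exp.tendsto _).comp (ht.const_mul θ))
  refine tendsto_of_le_liminf_of_limsup_le ?_ ?_
  · calc ∫⁻ t, ENNReal.ofReal (Real.exp (θ * g t)) ∂m
        = ∫⁻ t, liminf (fun n => ENNReal.ofReal (Real.exp (θ * f n t))) atTop ∂m := by
          refine lintegral_congr_ae ?_
          filter_upwards [hlim'] with t ht using ht.liminf_eq.symm
      _ ≤ _ := lintegral_liminf_le fun n => by fun_prop
  · have hL : ∀ L : ℕ, limsup (fun n => ∫⁻ t, ENNReal.ofReal (Real.exp (θ * f n t)) ∂m) atTop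
        ≤ ∫⁻ t, ENNReal.ofReal (Real.exp (θ * g t)) ∂m
          + ENNReal.ofReal (Real.exp (-((1 - θ) * L))) * C := by
      intro L
      -- For `y ≥ L` one has `θ y ≤ y - (1 - θ) L`, so the part above level `L` is at most `exp (-(1
      -- - θ) L)` times the bounded integral of `exp fₙ`. This uses `θ < 1`.
      have hpt : ∀ y : ℝ, ENNReal.ofReal (Real.exp (θ * y)) ≤
          ENNReal.ofReal (Real.exp (θ * min y L))
            + ENNReal.ofReal (Real.exp (-((1 - θ) * L))) * ENNReal.ofReal (Real.exp y) := by
        intro y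
        rcases le_total y L with h | h
        · rw [min_eq_left h]; exact le_self_add
        · rw [← ofReal_exp_add]
          refine le_trans (ENNReal.ofReal_le_ofReal (Real.exp_le_exp.2 ?_)) le_add_self
          nlinarith
      have hmin : Tendsto (fun n => ∫⁻ t, ENNReal.ofReal (Real.exp (θ * min (f n t) L)) ∂m) atTop
          (𝓝 (∫⁻ t, ENNReal.ofReal (Real.exp (θ * min (g t) L)) ∂m)) := by
        refine tendsto_lintegral_of_dominated_convergence
          (fun _ => ENNReal.ofReal (Real.exp (θ * L))) (fun n => by fun_prop)
          (fun n => ae_of_all _ fun t => ?_) ?_ ?_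
        · refine ENNReal.ofReal_le_ofReal (Real.exp_le_exp.2 ?_)
          exact mul_le_mul_of_nonneg_left (min_le_right _ _) h0.le
        · rw [lintegral_const]
          exact ENNReal.mul_ne_top ENNReal.ofReal_ne_top (measure_ne_top _ _)
        · filter_upwards [hlim] with t ht
          exact ENNReal.tendsto_ofReal ((Real.continuous_exp.tendsto _).comp
            ((ht.min tendsto_const_nhds).const_mul θ))
      have hle : ∀ᶠ n in atTop, ∫⁻ t, ENNReal.ofReal (Real.exp (θ * f n t)) ∂m
          ≤ ∫⁻ t, ENNReal.ofReal (Real.exp (θ * min (f n t) L)) ∂m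
            + ENNReal.ofReal (Real.exp (-((1 - θ) * L))) * C := by
        filter_upwards [hb] with n hn
        refine (lintegral_mono fun t => hpt (f n t)).trans ?_
        rw [lintegral_add_left (by fun_prop), lintegral_const_mul' _ _ ENNReal.ofReal_ne_top]
        gcongr
      refine (limsup_le_limsup hle).trans ?_
      rw [(hmin.add_const _).limsup_eq]
      gcongr
      exact min_le_left _ _
    have h2 : Tendsto (fun L : ℕ => ∫⁻ t, ENNReal.ofReal (Real.exp (θ * g t)) ∂m
          + ENNReal.ofReal (Real.exp (-((1 - θ) * L))) * C) atTop
        (𝓝 (∫⁻ t, ENNReal.ofReal (Real.exp (θ * g t)) ∂m + ENNReal.ofReal 0 * C)) := by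
      refine (ENNReal.Tendsto.mul_const (ENNReal.tendsto_ofReal ?_) (Or.inr hC)).const_add _
      refine Real.tendsto_exp_atBot.comp (tendsto_neg_atTop_atBot.comp ?_)
      exact tendsto_natCast_atTop_atTop.const_mul_atTop (by linarith)
    simpa using ge_of_tendsto' h2 hL

/-- If `∫ exp g < ∞` and `θₙ → 1`, `0 ≤ θₙ ≤ 1`, then `∫ exp (θₙ g) → ∫ exp g`. -/
theorem tendsto_lintegral_exp_mul_one (m : Measure T) [IsFiniteMeasure m] {g : T → ℝ}
    (hg : Measurable g) (hfin : ∫⁻ t, ENNReal.ofReal (Real.exp (g t)) ∂m ≠ ∞) {θ : ℕ → ℝ}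
    (hθ : ∀ n, θ n ∈ Set.Icc (0 : ℝ) 1) (hlim : Tendsto θ atTop (𝓝 1)) :
    Tendsto (fun n => ∫⁻ t, ENNReal.ofReal (Real.exp (θ n * g t)) ∂m) atTop
      (𝓝 (∫⁻ t, ENNReal.ofReal (Real.exp (g t)) ∂m)) := by
  refine tendsto_lintegral_of_dominated_convergence
    (fun t => 1 + ENNReal.ofReal (Real.exp (g t))) (fun n => by fun_prop)
    (fun n => ae_of_all _ fun t => ?_) ?_ (ae_of_all _ fun t => ?_)
  · have := hθ n
    rcases le_total 0 (g t) with h | h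
    · refine le_trans (ENNReal.ofReal_le_ofReal (Real.exp_le_exp.2 ?_)) le_add_self
      nlinarith [this.1, this.2]
    · refine le_trans ?_ le_self_add
      rw [← ENNReal.ofReal_one]
      refine ENNReal.ofReal_le_ofReal (Real.exp_le_one_iff.2 ?_)
      exact mul_nonpos_of_nonneg_of_nonpos this.1 h
  · rw [lintegral_add_left measurable_const, lintegral_one]
    exact ENNReal.add_ne_top.2 ⟨measure_ne_top _ _, hfin⟩
  · have := hlim.mul_const (g t)
    rw [one_mul] at this
    exact ENNReal.tendsto_ofReal ((Real.continuous_exp.tendsto _).comp this)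

namespace IsChaos

variable {γ : Measure (ℕ → ℝ)} {μ : Measure T} {z : T → ℕ → ℝ} {M : Kernel (ℕ → ℝ) T}
  {S : Type*} [MeasurableSpace S] {ν : Measure S} {w : S → ℕ → ℝ}

/-- Provides measurability of exceptional sets in `(x, s)`, which allows a.e. claims on `γ ⊗ ν` to
be checked for fixed `s`. -/
theorem measurable_setLIntegral (hM : IsChaos γ μ z M) {f : T × S → ℝ≥0∞} (hf : Measurable f)
    {A : Set T} (hA : MeasurableSet A) :
    Measurable fun p : (ℕ → ℝ) × S => ∫⁻ t in A, f (t, p.2) ∂(M p.1) := by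
  have := hM.isSFiniteKernel
  have := Measurable.setLIntegral_kernel_prod_right (κ := Kernel.prodMkRight S M)
    (f := fun (p : (ℕ → ℝ) × S) t => f (t, p.2)) (by fun_prop) hA
  simpa only [Kernel.prodMkRight_apply] using this

/-- A null set of `μ ⊗ ν` is not seen by `M(x, dt) ν(ds)`. -/
theorem ae_prod_ae [IsProbabilityMeasure μ] [IsProbabilityMeasure ν] (hM : IsChaos γ μ z M)
    [IsProbabilityMeasure γ] {p : T × S → Prop} (hp : ∀ᵐ q ∂(μ.prod ν), p q) :
    ∀ᵐ q ∂(γ.prod ν), ∀ᵐ t ∂(M q.1), p (t, q.2) := by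
  have := hM.isSFiniteKernel
  set N := toMeasurable (μ.prod ν) {q | ¬ p q} with hN
  have hNm : MeasurableSet N := measurableSet_toMeasurable _ _
  have hN0 : (μ.prod ν) N = 0 := by rw [hN, measure_toMeasurable]; exact hp
  have h1 : ∀ᵐ s ∂ν, ∀ᵐ t ∂μ, (t, s) ∉ N := by
    have := (Measure.ae_prod_iff_ae_ae (p := fun q => q ∉ N) hNm.compl).1
      (measure_eq_zero_iff_ae_notMem.1 hN0)
    exact (Measure.ae_ae_comm (p := fun t s => (t, s) ∉ N) hNm.compl).1 this
  have hms : MeasurableSet {q : (ℕ → ℝ) × S | ∀ᵐ t ∂(M q.1), (t, q.2) ∉ N} := by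
    have hm := hM.measurable_setLIntegral (S := S) (f := N.indicator 1)
      (measurable_one.indicator hNm) MeasurableSet.univ
    have := hm (measurableSet_singleton 0)
    convert this using 1
    ext q
    simp only [Set.mem_ofPred_eq, Set.mem_preimage, Set.mem_singleton_iff, Measure.restrict_univ]
    refine (measure_eq_zero_iff_ae_notMem (s := {t | (t, q.2) ∈ N})).symm.trans ?_
    rw [← lintegral_indicator_one (s := {t | (t, q.2) ∈ N}) (by exact hNm.preimage (by fun_prop))]
    rfl
  have h2 : ∀ᵐ q ∂(γ.prod ν), ∀ᵐ t ∂(M q.1), (t, q.2) ∉ N := by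
    rw [Measure.ae_prod_iff_ae_ae hms,
      Measure.ae_ae_comm (p := fun x s => ∀ᵐ t ∂(M x), (t, s) ∉ N) hms]
    filter_upwards [h1] with s hs
    exact hM.ae_ae hs
  filter_upwards [h2] with q hq
  filter_upwards [hq] with t ht
  by_contra h
  exact ht (subset_toMeasurable _ _ h)

/-- The shift property for finite-dimensional random shifts. -/
theorem ae_shift_cut [IsProbabilityMeasure ν] (hM : IsChaos γ μ z M) [IsProbabilityMeasure γ]
    (hz : Measurable z) (hw : Measurable w) (θ : ℝ) (n : ℕ) {A : Set T} (hA : MeasurableSet A) :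
    ∀ᵐ p ∂(γ.prod ν), M (p.1 + cut θ n * w p.2) A
      = ∫⁻ t in A, ENNReal.ofReal (Real.exp (θ * kerSum n (z t) (w p.2))) ∂(M p.1) := by
  have hms : MeasurableSet {p : (ℕ → ℝ) × S | M (p.1 + cut θ n * w p.2) A
      = ∫⁻ t in A, ENNReal.ofReal (Real.exp (θ * kerSum n (z t) (w p.2))) ∂(M p.1)} := by
    refine measurableSet_eq_fun ((M.measurable_coe hA).comp (by fun_prop)) ?_
    exact hM.measurable_setLIntegral
      (f := fun q => ENNReal.ofReal (Real.exp (θ * kerSum n (z q.1) (w q.2)))) (by fun_prop) hA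
  rw [Measure.ae_prod_iff_ae_ae hms,
    Measure.ae_ae_comm (p := fun x s => M (x + cut θ n * w s) A
      = ∫⁻ t in A, ENNReal.ofReal (Real.exp (θ * kerSum n (z t) (w s))) ∂(M x)) hms]
  -- For fixed `s` the truncated shift is deterministic and finitely supported, so the defining
  -- property of the chaos applies.
  refine ae_of_all _ fun s => ?_
  filter_upwards [hM.shift (trunc θ n (w s))] with x hx
  rw [← coe_trunc, hx, withDensity_apply _ hA]
  simp_rw [lf_trunc]

/-- The shift property for randomized shifts, on a measurable set: if `K` is a limit of
`∑_{k < n} zₖ(t) wₖ(s)` along a subsequence, then `M(x + w(s), dt) = e^{K(t, s)} M(x, dt)`. -/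
theorem ae_shift_apply [IsProbabilityMeasure μ] [IsProbabilityMeasure ν] (hM : IsChaos γ μ z M)
    (hγ : IsGaussianSeq γ) (hz : Measurable z) (hw : Measurable w) (hac : shiftLaw γ ν w ≪ γ)
    {K : T × S → ℝ} (hK : Measurable K)
    {ns : ℕ → ℕ} (hns : StrictMono ns) (hlim : ∀ᵐ q ∂(μ.prod ν),
      Tendsto (fun j => kerSum (ns j) (z q.1) (w q.2)) atTop (𝓝 (K q)))
    {A : Set T} (hA : MeasurableSet A) :
    ∀ᵐ p ∂(γ.prod ν), M (p.1 + w p.2) A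
      = ∫⁻ t in A, ENNReal.ofReal (Real.exp (K (t, p.2))) ∂(M p.1) := by
  have := hγ.prob
  have hfin := hM.finite
  have hKae' := hM.ae_prod_ae hlim
  have hF : ∀ B : Set T, MeasurableSet B → Measurable fun x => (M x B).toReal := fun B hB =>
    (M.measurable_coe hB).ennreal_toReal
  have toENN : ∀ {B : Set T} {u : ℕ → ℕ → ℝ} {x : ℕ → ℝ},
      Tendsto (fun j => (M (u j) B).toReal) atTop (𝓝 (M x B).toReal) →
      Tendsto (fun j => M (u j) B) atTop (𝓝 (M x B)) := fun h =>
    (ENNReal.tendsto_toReal_iff (fun j => measure_ne_top _ _) (measure_ne_top _ _)).1 h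
  -- a subsequence along which the total masses are bounded
  obtain ⟨ms, hms, hmass⟩ := exists_seq_tendsto_shift hγ hw hac (hF _ MeasurableSet.univ)
    (α := fun j => cut 1 (ns j)) (a := fun _ => 1) (fun j => cut_mem_Icc (by simp) _)
    (fun k => by simp) (fun k => (tendsto_cut 1 k).comp hns.tendsto_atTop)
  have hnm : StrictMono fun j => ns (ms j) := hns.comp hms
  have hone : ∀ y : ℕ → ℝ, (fun _ : ℕ => (1 : ℝ)) * y = y := fun y => by ext; simp
  -- the total masses of `M(x + wⁿ)` as integrals, for all `n`
  have hcut1 : ∀ᵐ p ∂(γ.prod ν), ∀ n, M (p.1 + cut 1 n * w p.2) Set.univ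
      = ∫⁻ t, ENNReal.ofReal (Real.exp (kerSum n (z t) (w p.2))) ∂(M p.1) := by
    rw [ae_all_iff]
    intro n
    filter_upwards [hM.ae_shift_cut hz hw 1 n MeasurableSet.univ] with p hp
    rw [hp, Measure.restrict_univ]
    simp_rw [one_mul]
  -- By Fatou the integral of `exp K` is at most the limit of the total masses of `M(x + wⁿ)`, that
  -- is, the finite mass of `M(x + w)`.
  have hexp : ∀ᵐ p ∂(γ.prod ν),
      ∫⁻ t, ENNReal.ofReal (Real.exp (K (t, p.2))) ∂(M p.1) ≠ ∞ := by
    filter_upwards [hKae', hmass, hcut1] with p h1 h2 h3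
    refine ne_top_of_le_ne_top (measure_ne_top (M (p.1 + w p.2)) Set.univ) ?_
    calc ∫⁻ t, ENNReal.ofReal (Real.exp (K (t, p.2))) ∂(M p.1)
        = ∫⁻ t, liminf (fun j => ENNReal.ofReal
            (Real.exp (kerSum (ns (ms j)) (z t) (w p.2)))) atTop ∂(M p.1) := by
          refine lintegral_congr_ae ?_
          filter_upwards [h1] with t ht
          exact (ENNReal.tendsto_ofReal ((Real.continuous_exp.tendsto _).comp
            (ht.comp hms.tendsto_atTop))).liminf_eq.symm
      _ ≤ liminf (fun j => ∫⁻ t, ENNReal.ofReal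
            (Real.exp (kerSum (ns (ms j)) (z t) (w p.2))) ∂(M p.1)) atTop :=
          lintegral_liminf_le fun j => by fun_prop
      _ = M (p.1 + w p.2) Set.univ := by
          have := toENN h2
          simp only [hone, h3] at this
          exact this.liminf_eq
  -- contracted shifts
  have hθ : ∀ θ : ℝ, 0 < θ → θ < 1 → ∀ᵐ p ∂(γ.prod ν), M (p.1 + (fun _ => θ) * w p.2) A
      = ∫⁻ t in A, ENNReal.ofReal (Real.exp (θ * K (t, p.2))) ∂(M p.1) := by
    intro θ h0 h1
    have hθI : θ ∈ Set.Icc (0 : ℝ) 1 := ⟨h0.le, h1.le⟩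
    obtain ⟨ls, hls, hA'⟩ := exists_seq_tendsto_shift hγ hw hac (hF A hA)
      (α := fun j => cut θ (ns (ms j))) (a := fun _ => θ) (fun j => cut_mem_Icc hθI _)
      (fun k => hθI) (fun k => (tendsto_cut θ k).comp hnm.tendsto_atTop)
    have hcut : ∀ᵐ p ∂(γ.prod ν), ∀ n, M (p.1 + cut θ n * w p.2) A
        = ∫⁻ t in A, ENNReal.ofReal (Real.exp (θ * kerSum n (z t) (w p.2))) ∂(M p.1) :=
      ae_all_iff.2 fun n => hM.ae_shift_cut hz hw θ n hA
    filter_upwards [hKae', hmass, hcut1, hA', hcut] with p g1 g2 g3 g4 g5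
    have g4' := toENN g4
    simp only [g5] at g4'
    refine tendsto_nhds_unique g4' ?_
    have g2' := toENN g2
    simp only [hone, g3] at g2'
    -- The convergent masses, eventually at most their limit plus one, bound the integrals of `exp
    -- Kₙ`; together with `θ < 1` this permits the limit under the integral.
    refine tendsto_lintegral_exp_mul ((M p.1).restrict A)
      (f := fun j t => kerSum (ns (ms (ls j))) (z t) (w p.2)) (g := fun t => K (t, p.2))
      (fun j => by fun_prop) ?_ (C := M (p.1 + w p.2) Set.univ + 1)
      (ENNReal.add_ne_top.2 ⟨measure_ne_top _ _, ENNReal.one_ne_top⟩) ?_ h0 h1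
    · refine ae_restrict_of_ae ?_
      filter_upwards [g1] with t ht
      exact ht.comp (hms.comp hls).tendsto_atTop
    · have g2'' := g2'.comp hls.tendsto_atTop
      filter_upwards [g2''.eventually_le_const
        (ENNReal.lt_add_right (measure_ne_top _ _) one_ne_zero)] with j hj
      exact (lintegral_mono' Measure.restrict_le_self le_rfl).trans hj
  -- let the contraction factor tend to one
  let θ : ℕ → ℝ := fun j => 1 - 1 / ((j : ℝ) + 2)
  have hθ0 : ∀ j, 0 < θ j := fun j => by
    have : (1 : ℝ) / ((j : ℝ) + 2) < 1 := by
      rw [div_lt_one (by positivity)]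
      have : (0 : ℝ) ≤ j := by positivity
      linarith
    simp only [θ]
    linarith
  have hθ1 : ∀ j, θ j < 1 := fun j => by
    have : 0 < (1 : ℝ) / ((j : ℝ) + 2) := by positivity
    simp only [θ]
    linarith
  have hθlim : Tendsto θ atTop (𝓝 1) := by
    have h1 : Tendsto (fun j : ℕ => 1 / ((j : ℝ) + 2)) atTop (𝓝 0) := by
      simp_rw [one_div]
      exact tendsto_inv_atTop_zero.comp
        (tendsto_atTop_add_const_right _ _ tendsto_natCast_atTop_atTop)
    simpa [θ] using h1.const_sub 1
  obtain ⟨ls, hls, hA'⟩ := exists_seq_tendsto_shift hγ hw hac (hF A hA)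
      (α := fun j _ => θ j) (a := fun _ => 1) (fun j k => ⟨(hθ0 j).le, (hθ1 j).le⟩)
      (fun k => by simp) (fun k => hθlim)
  filter_upwards [hA', hexp, ae_all_iff.2 fun j => hθ (θ j) (hθ0 j) (hθ1 j)] with p g1 g2 g3
  have g1' := toENN g1
  simp only [g3, hone] at g1'
  refine tendsto_nhds_unique g1' ?_
  exact tendsto_lintegral_exp_mul_one ((M p.1).restrict A) (by fun_prop)
    (ne_top_of_le_ne_top g2 (lintegral_mono' Measure.restrict_le_self le_rfl))
    (fun j => ⟨(hθ0 _).le, (hθ1 _).le⟩) (hθlim.comp hls.tendsto_atTop)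

theorem ae_shift [StandardBorelSpace T] [IsProbabilityMeasure μ] [IsProbabilityMeasure ν]
    (hM : IsChaos γ μ z M)
    (hγ : IsGaussianSeq γ) (hz : Measurable z) (hw : Measurable w) (hac : shiftLaw γ ν w ≪ γ)
    {K : T × S → ℝ} (hK : Measurable K)
    {ns : ℕ → ℕ} (hns : StrictMono ns) (hlim : ∀ᵐ q ∂(μ.prod ν),
      Tendsto (fun j => kerSum (ns j) (z q.1) (w q.2)) atTop (𝓝 (K q))) :
    ∀ᵐ p ∂(γ.prod ν), M (p.1 + w p.2)
      = (M p.1).withDensity fun t => ENNReal.ofReal (Real.exp (K (t, p.2))) := by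
  refine ae_eq_of_forall_measurableSet (ae_of_all _ fun p => hM.finite _) fun A hA => ?_
  filter_upwards [hM.ae_shift_apply hγ hz hw hac hK hns hlim hA] with p hp
  rw [hp, withDensity_apply _ hA]

end IsChaos

end GMC

/-! ### Second moments and nonatomicity -/

namespace GMC

variable {T : Type*} [MeasurableSpace T] {γ : Measure (ℕ → ℝ)} {μ : Measure T}
  {z w : T → ℕ → ℝ} {M M' : Kernel (ℕ → ℝ) T}

/-- The second moment formula `E [M ⊗ M'] = e^K · μ ⊗ μ`. -/
theorem IsChaos.lintegral_prod_apply [IsProbabilityMeasure μ] (hγ : IsGaussianSeq γ)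
    (hM : IsChaos γ μ z M) (hM' : IsChaos γ μ w M') (hw : Measurable w)
    {K : T × T → ℝ} (hK : Measurable K)
    (hs : ∀ᵐ p ∂(γ.prod μ), M (p.1 + w p.2)
      = (M p.1).withDensity fun t => ENNReal.ofReal (Real.exp (K (t, p.2))))
    {B : Set (T × T)} (hB : MeasurableSet B) :
    ∫⁻ x, ((M x).prod (M' x)) B ∂γ
      = ((μ.prod μ).withDensity fun p => ENNReal.ofReal (Real.exp (K p))) B := by
  have := hγ.prob
  have := hM.isSFiniteKernel
  have := hM.finite
  have := hM'.finite
  have hBs : ∀ s, MeasurableSet ((fun t => (t, s)) ⁻¹' B) := fun s => hB.preimage (by fun_prop)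
  have hF : Measurable fun p : (ℕ → ℝ) × T => M p.1 ((fun t => (t, p.2)) ⁻¹' B) := by
    have := hM.measurable_setLIntegral (S := T) (f := B.indicator 1) (measurable_one.indicator hB)
      MeasurableSet.univ
    simp only [Measure.restrict_univ] at this
    convert this using 2 with p
    rw [← lintegral_indicator_one (hBs _)]
    rfl
  have hf : Measurable (B.indicator fun p => ENNReal.ofReal (Real.exp (K p))) :=
    Measurable.indicator (by fun_prop) hB
  -- The Peyrière formula replaces `M'(x, ds)` by `μ(ds)` at the cost of moving `x` to `x + w(s)`;
  -- `hs` then turns this shift into the factor `e^K`.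
  calc ∫⁻ x, ((M x).prod (M' x)) B ∂γ
      = ∫⁻ x, ∫⁻ s, M x ((fun t => (t, s)) ⁻¹' B) ∂(M' x) ∂γ :=
        lintegral_congr fun x => Measure.prod_apply_symm hB
    _ = ∫⁻ p, M (p.1 + w p.2) ((fun t => (t, p.2)) ⁻¹' B) ∂(γ.prod μ) :=
        hM'.lintegral_peyriere hγ hw hF
    _ = ∫⁻ p, ∫⁻ t, B.indicator (fun p => ENNReal.ofReal (Real.exp (K p))) (t, p.2) ∂(M p.1)
          ∂(γ.prod μ) := by
        refine lintegral_congr_ae ?_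
        filter_upwards [hs] with p hp
        rw [hp, withDensity_apply _ (hBs _), ← lintegral_indicator (hBs _)]
        rfl
    _ = ∫⁻ s, ∫⁻ t, B.indicator (fun p => ENNReal.ofReal (Real.exp (K p))) (t, s) ∂μ ∂μ := by
        rw [lintegral_prod_symm' (fun p : (ℕ → ℝ) × T =>
          ∫⁻ t, B.indicator (fun p => ENNReal.ofReal (Real.exp (K p))) (t, p.2) ∂(M p.1))]
        · exact lintegral_congr fun s => hM.lintegral_lintegral
            (f := fun t => B.indicator (fun p => ENNReal.ofReal (Real.exp (K p))) (t, s))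
            (hf.comp (by fun_prop))
        · simpa only [Measure.restrict_univ] using hM.measurable_setLIntegral hf MeasurableSet.univ
    _ = _ := by
        rw [withDensity_apply _ hB, ← lintegral_indicator hB, lintegral_prod_symm' _ hf]

/-- The chaos over a nonatomic measure is nonatomic. -/
theorem IsChaos.ae_nonatomic [StandardBorelSpace T] [IsProbabilityMeasure μ]
    [IsProbabilityMeasure γ] (hM : IsChaos γ μ z M) {K : T × T → ℝ}
    (h : ∀ B : Set (T × T), MeasurableSet B → ∫⁻ x, ((M x).prod (M x)) B ∂γ
      = ((μ.prod μ).withDensity fun p => ENNReal.ofReal (Real.exp (K p))) B)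
    (hμ : ∀ t, μ {t} = 0) : ∀ᵐ x ∂γ, ∀ t, M x {t} = 0 := by
  have := hM.isSFiniteKernel
  have := hM.finite
  have hd : MeasurableSet (Set.diagonal T) := measurableSet_diagonal
  -- An atom of `M x` would give `M x ⊗ M x` positive mass on the diagonal, which is null for `μ ⊗
  -- μ` and hence for the second moment.
  have h0 : (μ.prod μ) (Set.diagonal T) = 0 := by
    rw [Measure.prod_apply hd]
    refine (lintegral_congr fun t => ?_).trans lintegral_zero
    rw [show Prod.mk t ⁻¹' Set.diagonal T = {t} by ext; simp [eq_comm]]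
    exact hμ t
  have h1 := (h _ hd).trans (withDensity_absolutelyContinuous _ _ h0)
  have hm : Measurable fun x => ((M x).prod (M x)) (Set.diagonal T) := by
    have := (M ×ₖ M).measurable_coe hd
    simpa only [Kernel.prod_apply] using this
  filter_upwards [(lintegral_eq_zero_iff hm).1 h1] with x hx t
  have h2 : ((M x).prod (M x)) ({t} ×ˢ {t}) = 0 :=
    measure_mono_null (by rintro ⟨a, b⟩ ⟨ha, hb⟩; exact ha.trans hb.symm) hx
  rw [Measure.prod_prod] at h2
  exact mul_self_eq_zero.1 h2

/-! ### A weight bounding polynomial functionals of a randomized shift -/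

/-- The signs `±1`. -/
def sgn (b : Bool) : ℝ := if b then 1 else -1

theorem IsGaussianSeq.map_sgn (hγ : IsGaussianSeq γ) (b : Bool) :
    γ.map (fun x => sgn b • x) = γ := by
  cases b
  · simpa [sgn] using hγ.map_neg
  · simp [sgn]

theorem IsGaussianSeq.lintegral_prod_sgn (hγ : IsGaussianSeq γ) (σ : Bool × Bool)
    {f : (ℕ → ℝ) × (ℕ → ℝ) → ℝ≥0∞} (hf : Measurable f) :
    ∫⁻ p, f (sgn σ.1 • p.1, sgn σ.2 • p.2) ∂(γ.prod γ) = ∫⁻ p, f p ∂(γ.prod γ) := by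
  have := hγ.prob
  have h := Measure.map_prod_map γ γ (f := fun x : ℕ → ℝ => sgn σ.1 • x)
    (g := fun x : ℕ → ℝ => sgn σ.2 • x) (by fun_prop) (by fun_prop)
  rw [hγ.map_sgn, hγ.map_sgn] at h
  conv_rhs => rw [h]
  rw [lintegral_map hf (by fun_prop)]
  rfl

theorem IsGaussianSeq.lintegral_rotate_pair (hγ : IsGaussianSeq γ) {r : ℝ} (hr : r ^ 2 = 1 / 2)
    {f : (ℕ → ℝ) × (ℕ → ℝ) → ℝ≥0∞} (hf : Measurable f) :
    ∫⁻ p, f (r • (p.1 + p.2), r • (p.1 - p.2)) ∂(γ.prod γ) = ∫⁻ p, f p ∂(γ.prod γ) := by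
  conv_rhs => rw [← hγ.map_rotate_pair hr]
  rw [lintegral_map hf (by fun_prop)]

theorem smul_rotate {r : ℝ} (hr : r ^ 2 = 1 / 2) (u v : ℕ → ℝ) :
    r • (r • (u + v) + r • (u - v)) = u := by
  rw [← smul_add, smul_smul, ← pow_two, hr, add_add_sub_cancel, ← two_smul ℝ u, smul_smul]
  norm_num

/-- A positive weight that compensates the density of the law of `x + z(t)`. -/
theorem exists_damping [IsProbabilityMeasure μ] [IsProbabilityMeasure γ] (hz : Measurable z)
    (hac : shiftLaw γ μ z ≪ γ) :
    ∃ φ : (ℕ → ℝ) → ℝ≥0∞, Measurable φ ∧ (∀ x, 0 < φ x) ∧ (∀ x, φ x ≤ 1) ∧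
      ∀ f : (ℕ → ℝ) → ℝ≥0∞, Measurable f →
        ∫⁻ t, ∫⁻ x, φ (x + z t) * f (x + z t) ∂γ ∂μ ≤ ∫⁻ x, f x ∂γ := by
  set D := (shiftLaw γ μ z).rnDeriv γ with hD
  have hDm : Measurable D := Measure.measurable_rnDeriv _ _
  have hm : Measurable fun p : (ℕ → ℝ) × T => p.1 + z p.2 := by fun_prop
  have : IsProbabilityMeasure (shiftLaw γ μ z) := Measure.isProbabilityMeasure_map hm.aemeasurable
  -- The weight is `1 / (1 + D)`. Passing through `toReal` keeps it positive also on the null set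
  -- where `D = ∞`.
  have hφm : Measurable fun x => (1 + ENNReal.ofReal (D x).toReal)⁻¹ := by fun_prop
  refine ⟨fun x => (1 + ENNReal.ofReal (D x).toReal)⁻¹, hφm, fun x => by simp,
    fun x => ENNReal.inv_le_one.2 le_self_add, fun f hf => ?_⟩
  rw [lintegral_shiftLaw hz hac (f := fun x => (1 + ENNReal.ofReal (D x).toReal)⁻¹ * f x)
    (by fun_prop)]
  refine lintegral_mono_ae ?_
  filter_upwards [ae_lt_top hDm (Measure.lintegral_rnDeriv_lt_top _ _).ne] with x hx
  rw [← mul_assoc, ENNReal.ofReal_toReal hx.ne, ← div_eq_mul_inv]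
  exact mul_le_of_le_one_left' (ENNReal.div_le_of_le_mul (by rw [one_mul]; exact le_add_self))

/-- Rotate the pair by `π/4`: adding `r z` to both coordinates adds `z` to `u = r (x + y)` alone,
since `2 r² = 1`. The independent component `v` is untouched, and `φ (u + z)` absorbs the density of
`u + z`. -/
theorem lintegral_damped_le [IsProbabilityMeasure μ] (hγ : IsGaussianSeq γ) (hz : Measurable z)
    {r : ℝ} (hr : r ^ 2 = 1 / 2) {φ : (ℕ → ℝ) → ℝ≥0∞} (hφm : Measurable φ)
    (hφ : ∀ f : (ℕ → ℝ) → ℝ≥0∞, Measurable f →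
        ∫⁻ t, ∫⁻ x, φ (x + z t) * f (x + z t) ∂γ ∂μ ≤ ∫⁻ x, f x ∂γ)
    {G : (ℕ → ℝ) × (ℕ → ℝ) → ℝ≥0∞} (hG : Measurable G) :
    ∫⁻ t, ∫⁻ p, φ (r • (p.1 + p.2) + z t) * G (p.1 + r • z t, p.2 + r • z t) ∂(γ.prod γ) ∂μ
      ≤ ∫⁻ p, G p ∂(γ.prod γ) := by
  have := hγ.prob
  calc ∫⁻ t, ∫⁻ p, φ (r • (p.1 + p.2) + z t) * G (p.1 + r • z t, p.2 + r • z t) ∂(γ.prod γ) ∂μ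
      = ∫⁻ t, ∫⁻ v, ∫⁻ u, φ (u + z t) * G (r • (u + z t + v), r • (u + z t - v)) ∂γ ∂γ ∂μ := by
        refine lintegral_congr fun t => ?_
        rw [← hγ.lintegral_rotate_pair hr (by fun_prop), lintegral_prod_symm' _ (by fun_prop)]
        refine lintegral_congr fun v => lintegral_congr fun u => ?_
        simp only [smul_rotate hr]
        congr 3
        · rw [← smul_add]; congr 1; abel
        · rw [← smul_add]; congr 1; abel
    _ = ∫⁻ v, ∫⁻ t, ∫⁻ u, φ (u + z t) * G (r • (u + z t + v), r • (u + z t - v)) ∂γ ∂μ ∂γ :=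
        lintegral_lintegral_swap (Measurable.lintegral_prod_right' (ν := γ)
          (f := fun q : (T × (ℕ → ℝ)) × (ℕ → ℝ) => φ (q.2 + z q.1.1) *
            G (r • (q.2 + z q.1.1 + q.1.2), r • (q.2 + z q.1.1 - q.1.2)))
          (by fun_prop)).aemeasurable
    _ ≤ ∫⁻ v, ∫⁻ u, G (r • (u + v), r • (u - v)) ∂γ ∂γ :=
        lintegral_mono fun v => hφ (fun u => G (r • (u + v), r • (u - v))) (by fun_prop)
    _ = ∫⁻ p, G p ∂(γ.prod γ) := by
        rw [← hγ.lintegral_rotate_pair hr hG, lintegral_prod_symm' _ (by fun_prop)]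

/-- For a randomized shift there is a positive weight under which polynomial functionals of
the shift are controlled by their Gaussian counterparts. -/
theorem exists_weight [IsProbabilityMeasure μ] (hγ : IsGaussianSeq γ) (hz : Measurable z)
    (hac : shiftLaw γ μ z ≪ γ) {r : ℝ} (hr : r ^ 2 = 1 / 2) :
    ∃ h : T → ℝ≥0∞, Measurable h ∧ (∀ t, 0 < h t) ∧ (∀ t, h t ≤ 1) ∧
      ∀ (g : (ℕ → ℝ) × (ℕ → ℝ) → ℝ) (m : T → ℝ), Measurable g →
        (∀ t x y, ∑ σ : Bool × Bool, g (sgn σ.1 • x + r • z t, sgn σ.2 • y + r • z t) = 4 * m t) →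
        ∫⁻ t, h t * ENNReal.ofReal (m t ^ 2) ∂μ
          ≤ ∫⁻ p, ENNReal.ofReal (g p ^ 2) ∂(γ.prod γ) := by
  have := hγ.prob
  obtain ⟨φ, hφm, hφ0, hφ1, hφ⟩ := exists_damping hz hac
  have J := fun G hG => lintegral_damped_le (G := G) hγ hz hr hφm hφ hG
  -- The minimum over all sign changes is a weight common to the four terms of the symmetrization
  -- that turns `g` into `m`; integrating out the Gaussian pair leaves a weight in `t` only.
  let ψ : T → (ℕ → ℝ) × (ℕ → ℝ) → ℝ≥0∞ := fun t p =>
    ⨅ σ : Bool × Bool, φ (r • (sgn σ.1 • p.1 + sgn σ.2 • p.2) + z t)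
  have hψm : Measurable fun q : T × ((ℕ → ℝ) × (ℕ → ℝ)) => ψ q.1 q.2 :=
    Measurable.iInf fun σ => by fun_prop
  have hψ0 : ∀ t p, 0 < ψ t p := fun t p => by
    obtain ⟨σ, hσ⟩ := exists_eq_ciInf_of_finite
      (f := fun σ : Bool × Bool => φ (r • (sgn σ.1 • p.1 + sgn σ.2 • p.2) + z t))
    exact (hφ0 _).trans_le hσ.le
  have hψ1 : ∀ t p, ψ t p ≤ 1 := fun t p => (iInf_le _ (true, true)).trans (hφ1 _)
  refine ⟨fun t => ∫⁻ p, ψ t p ∂(γ.prod γ), Measurable.lintegral_prod_right' (ν := γ.prod γ)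
    (f := fun q : T × ((ℕ → ℝ) × (ℕ → ℝ)) => ψ q.1 q.2) hψm, fun t => ?_, fun t => ?_,
    fun g m hg hgm => ?_⟩
  · have hψt : Measurable (ψ t) := Measurable.iInf fun σ => by fun_prop
    rw [lintegral_pos_iff_support hψt, Function.support_eq_univ (fun p => (hψ0 t p).ne')]
    simp
  · exact (lintegral_mono (hψ1 t)).trans (by simp)
  · have hsq : ∀ t, ∀ p : (ℕ → ℝ) × (ℕ → ℝ), 4 * ENNReal.ofReal (m t ^ 2) ≤ ∑ σ : Bool × Bool,
        ENNReal.ofReal (g (sgn σ.1 • p.1 + r • z t, sgn σ.2 • p.2 + r • z t) ^ 2) := by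
      intro t p
      rw [← ENNReal.ofReal_sum_of_nonneg (fun _ _ => sq_nonneg _),
        show (4 : ℝ≥0∞) = ENNReal.ofReal 4 by simp, ← ENNReal.ofReal_mul (by norm_num)]
      refine ENNReal.ofReal_le_ofReal ?_
      -- Cauchy–Schwarz over the four signs: `(4 m)² ≤ 4 ∑ g²`.
      have h1 := sq_sum_le_card_mul_sum_sq (s := (Finset.univ : Finset (Bool × Bool)))
        (f := fun σ => g (sgn σ.1 • p.1 + r • z t, sgn σ.2 • p.2 + r • z t))
      rw [hgm t p.1 p.2] at h1
      simp only [Finset.card_univ, Fintype.card_prod, Fintype.card_bool] at h1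
      push_cast at h1
      nlinarith
    have h4 : 4 * ∫⁻ t, (∫⁻ p, ψ t p ∂(γ.prod γ)) * ENNReal.ofReal (m t ^ 2) ∂μ
        ≤ 4 * ∫⁻ p, ENNReal.ofReal (g p ^ 2) ∂(γ.prod γ) := by
      calc 4 * ∫⁻ t, (∫⁻ p, ψ t p ∂(γ.prod γ)) * ENNReal.ofReal (m t ^ 2) ∂μ
          = ∫⁻ t, ∫⁻ p, ψ t p * (4 * ENNReal.ofReal (m t ^ 2)) ∂(γ.prod γ) ∂μ := by
            rw [← lintegral_const_mul' _ _ (by simp)]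
            refine lintegral_congr fun t => ?_
            rw [lintegral_mul_const' _ _ (by finiteness)]
            ring
        _ ≤ ∫⁻ t, ∫⁻ p, ∑ σ : Bool × Bool, φ (r • (sgn σ.1 • p.1 + sgn σ.2 • p.2) + z t) *
              ENNReal.ofReal (g (sgn σ.1 • p.1 + r • z t, sgn σ.2 • p.2 + r • z t) ^ 2)
              ∂(γ.prod γ) ∂μ := by
            refine lintegral_mono fun t => lintegral_mono fun p => ?_
            refine (mul_le_mul_right (hsq t p) _).trans ?_
            rw [Finset.mul_sum]
            exact Finset.sum_le_sum fun σ _ => mul_le_mul_left (iInf_le _ σ) _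
        _ = ∑ σ : Bool × Bool, ∫⁻ t, ∫⁻ p, φ (r • (p.1 + p.2) + z t) *
              ENNReal.ofReal (g (p.1 + r • z t, p.2 + r • z t) ^ 2) ∂(γ.prod γ) ∂μ := by
            rw [← lintegral_finsetSum' _ (fun σ _ => (Measurable.lintegral_prod_right'
              (ν := γ.prod γ) (f := fun q : T × ((ℕ → ℝ) × (ℕ → ℝ)) =>
                φ (r • (q.2.1 + q.2.2) + z q.1) *
              ENNReal.ofReal (g (q.2.1 + r • z q.1, q.2.2 + r • z q.1) ^ 2))
              (by fun_prop)).aemeasurable)]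
            refine lintegral_congr fun t => ?_
            rw [lintegral_finsetSum _ (fun σ _ => by fun_prop)]
            refine Finset.sum_congr rfl fun σ _ => ?_
            exact hγ.lintegral_prod_sgn σ (f := fun p => φ (r • (p.1 + p.2) + z t) *
              ENNReal.ofReal (g (p.1 + r • z t, p.2 + r • z t) ^ 2)) (by fun_prop)
        _ ≤ ∑ σ : Bool × Bool, ∫⁻ p, ENNReal.ofReal (g p ^ 2) ∂(γ.prod γ) :=
            Finset.sum_le_sum fun σ _ => J (fun p => ENNReal.ofReal (g p ^ 2)) (by fun_prop)
        _ = 4 * ∫⁻ p, ENNReal.ofReal (g p ^ 2) ∂(γ.prod γ) := by simp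
    exact (ENNReal.mul_le_mul_iff_right (by simp) (by simp)).1 h4

end GMC

/-! ### Quadratic forms and Hilbert–Schmidt bounds -/

namespace GMC

variable {T : Type*} [MeasurableSpace T] {γ : Measure (ℕ → ℝ)} {μ μ' : Measure T}
  {z w : T → ℕ → ℝ}

/-- The bilinear form `∑_{i, j < n} c i j xᵢ yⱼ`. -/
noncomputable def quad (n : ℕ) (c : ℕ → ℕ → ℝ) (x y : ℕ → ℝ) : ℝ :=
  kerSum n x fun i => kerSum n (c i) y

/-- The squared Hilbert–Schmidt norm of the truncated matrix `c`. -/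
noncomputable def hsq (n : ℕ) (c : ℕ → ℕ → ℝ) : ℝ :=
  ∑ i ∈ Finset.range n, ∑ j ∈ Finset.range n, c i j ^ 2

@[fun_prop]
theorem measurable_quad {S : Type*} [MeasurableSpace S] (n : ℕ) (c : ℕ → ℕ → ℝ) {f g : S → ℕ → ℝ}
    (hf : Measurable f) (hg : Measurable g) : Measurable fun s => quad n c (f s) (g s) := by
  unfold quad
  fun_prop

theorem nsq_trunc (n : ℕ) (a : ℕ → ℝ) : nsq (trunc 1 n a) = ∑ i ∈ Finset.range n, a i ^ 2 := by
  unfold nsq trunc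
  rw [Finsupp.onFinset_sum _ (by simp)]
  refine Finset.sum_congr rfl fun k hk => ?_
  simp [cut, Finset.mem_range.1 hk]

theorem IsGaussianSeq.lintegral_kerSum_sq (hγ : IsGaussianSeq γ) (n : ℕ) (a : ℕ → ℝ) :
    ∫⁻ x, ENNReal.ofReal (kerSum n x a ^ 2) ∂γ
      = ENNReal.ofReal (∑ i ∈ Finset.range n, a i ^ 2) := by
  rw [← nsq_trunc, ← hγ.lintegral_sq]
  simp_rw [lf_trunc, one_mul]

theorem kerSum_comm (n : ℕ) (x y : ℕ → ℝ) : kerSum n x y = kerSum n y x :=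
  Finset.sum_congr rfl fun _ _ => mul_comm _ _

/-- For fixed `y` the form is linear in `x`, with coefficients linear in `y`; the Gaussian isometry
is used once in each variable. -/
theorem IsGaussianSeq.lintegral_quad_sq (hγ : IsGaussianSeq γ) (n : ℕ) (c : ℕ → ℕ → ℝ) :
    ∫⁻ p, ENNReal.ofReal (quad n c p.1 p.2 ^ 2) ∂(γ.prod γ) = ENNReal.ofReal (hsq n c) := by
  have := hγ.prob
  rw [lintegral_prod_symm' _ (by fun_prop)]
  simp only [quad, hγ.lintegral_kerSum_sq]
  simp_rw [ENNReal.ofReal_sum_of_nonneg (fun _ _ => sq_nonneg _)]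
  rw [lintegral_finsetSum _ (fun i _ => by fun_prop)]
  simp_rw [kerSum_comm n (c _), hγ.lintegral_kerSum_sq]
  rw [hsq, ENNReal.ofReal_sum_of_nonneg (fun _ _ => Finset.sum_nonneg fun _ _ => sq_nonneg _)]

theorem kerSum_add_left (n : ℕ) (x x' y : ℕ → ℝ) :
    kerSum n (x + x') y = kerSum n x y + kerSum n x' y := by
  simp [kerSum, add_mul, Finset.sum_add_distrib]

theorem kerSum_smul_left (n : ℕ) (a : ℝ) (x y : ℕ → ℝ) :
    kerSum n (a • x) y = a * kerSum n x y := by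
  simp [kerSum, Finset.mul_sum, mul_assoc]

theorem quad_add_left (n : ℕ) (c : ℕ → ℕ → ℝ) (x x' y : ℕ → ℝ) :
    quad n c (x + x') y = quad n c x y + quad n c x' y := kerSum_add_left _ _ _ _

theorem quad_smul_left (n : ℕ) (c : ℕ → ℕ → ℝ) (a : ℝ) (x y : ℕ → ℝ) :
    quad n c (a • x) y = a * quad n c x y := kerSum_smul_left _ _ _ _

theorem quad_add_right (n : ℕ) (c : ℕ → ℕ → ℝ) (x y y' : ℕ → ℝ) :
    quad n c x (y + y') = quad n c x y + quad n c x y' := by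
  simp only [quad, kerSum_comm n (c _), kerSum_add_left]
  rw [kerSum_comm n x, kerSum_comm n x, kerSum_comm n x, ← kerSum_add_left]
  rfl

theorem quad_smul_right (n : ℕ) (c : ℕ → ℕ → ℝ) (a : ℝ) (x y : ℕ → ℝ) :
    quad n c x (a • y) = a * quad n c x y := by
  simp only [quad, kerSum_comm n (c _), kerSum_smul_left]
  rw [kerSum_comm n x, kerSum_comm n x, ← kerSum_smul_left]
  rfl

/-- Linear and quadratic functionals of `z` are bounded in `L²(μ')`. -/
structure IsHSBounded (μ' : Measure T) (z : T → ℕ → ℝ) (R : ℝ) : Prop where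
  linear : ∀ c, ∫⁻ t, ENNReal.ofReal (lf c (z t) ^ 2) ∂μ' ≤ ENNReal.ofReal (R * nsq c)
  quadratic : ∀ n c, ∫⁻ t, ENNReal.ofReal (quad n c (z t) (z t) ^ 2) ∂μ'
    ≤ ENNReal.ofReal (R * hsq n c)

theorem exists_weight_isHSBounded [IsProbabilityMeasure μ] (hγ : IsGaussianSeq γ)
    (hz : Measurable z) (hac : shiftLaw γ μ z ≪ γ) :
    ∃ h : T → ℝ≥0∞, Measurable h ∧ (∀ t, 0 < h t) ∧ (∀ t, h t ≤ 1) ∧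
      IsHSBounded (μ.withDensity h) z 4 := by
  have := hγ.prob
  obtain ⟨r, hr⟩ : ∃ r : ℝ, r ^ 2 = 1 / 2 := ⟨√(1 / 2), Real.sq_sqrt (by norm_num)⟩
  obtain ⟨h, hm, h0, h1, H⟩ := exists_weight hγ hz hac hr
  have hrr : r * r = 1 / 2 := by rw [← pow_two, hr]
  refine ⟨h, hm, h0, h1, fun c => ?_, fun n c => ?_⟩
  · rw [lintegral_withDensity_eq_lintegral_mul _ hm (by fun_prop)]
    -- The signs cancel `x` and `y`, leaving `8 r² = 4` times `lf c (z t)`. The constant one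
    -- obtained here is relaxed to `4` to match the quadratic case.
    refine (H (fun p => lf c (r • (p.1 + p.2))) (fun t => lf c (z t)) (by fun_prop) ?_).trans ?_
    · intro t x y
      simp only [Fintype.sum_prod_type, Fintype.sum_bool, sgn, lf_smul, lf_add, if_true,
        Bool.false_eq_true, if_false]
      linear_combination 8 * lf c (z t) * hrr
    · rw [← hγ.lintegral_rotate_pair hr (by fun_prop)]
      simp only [smul_rotate hr]
      rw [lintegral_prod_symm' _ (by fun_prop)]
      simp only [hγ.lintegral_sq, lintegral_const, measure_univ, mul_one]
      exact ENNReal.ofReal_le_ofReal (by linarith [nsq_nonneg c])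
  · rw [lintegral_withDensity_eq_lintegral_mul _ hm (by fun_prop)]
    -- Terms linear in `x` or `y` and the `xy` term cancel over the signs, leaving `4 r² = 2` times
    -- the form at `z`. So `m` is half of it, and squaring gives the constant `4`.
    have := H (fun p => quad n c p.1 p.2) (fun t => quad n c (z t) (z t) / 2) (by fun_prop) ?_
    · rw [hγ.lintegral_quad_sq] at this
      rw [ENNReal.ofReal_mul (by norm_num)]
      refine le_trans (le_of_eq ?_) (mul_le_mul_right this _)
      rw [← lintegral_const_mul' _ _ ENNReal.ofReal_ne_top]
      refine lintegral_congr fun t => ?_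
      rw [Pi.mul_apply, mul_left_comm, ← ENNReal.ofReal_mul (by norm_num)]
      congr 2
      ring
    · intro t x y
      simp only [Fintype.sum_prod_type, Fintype.sum_bool, sgn, quad_smul_left, quad_add_left,
        quad_smul_right, quad_add_right, if_true, Bool.false_eq_true, if_false]
      linear_combination 4 * quad n c (z t) (z t) * hrr

theorem IsHSBounded.mono {ν ν' : Measure T} {R R' : ℝ} (h : IsHSBounded ν z R) {a : ℝ≥0∞}
    (hν : ν' ≤ a • ν) (ha : a * ENNReal.ofReal R ≤ ENNReal.ofReal R') (hR' : 0 ≤ R')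
    (hR : 0 ≤ R) : IsHSBounded ν' z R' := by
  have key : ∀ (f : T → ℝ≥0∞) (b : ℝ), ∫⁻ t, f t ∂ν ≤ ENNReal.ofReal (R * b) →
      ∫⁻ t, f t ∂ν' ≤ ENNReal.ofReal (R' * b) := by
    intro f b hf
    calc ∫⁻ t, f t ∂ν' ≤ ∫⁻ t, f t ∂(a • ν) := lintegral_mono' hν le_rfl
      _ = a * ∫⁻ t, f t ∂ν := by rw [lintegral_smul_measure, smul_eq_mul]
      _ ≤ a * ENNReal.ofReal (R * b) := by gcongr
      _ ≤ ENNReal.ofReal (R' * b) := by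
        rw [ENNReal.ofReal_mul hR, ENNReal.ofReal_mul hR', ← mul_assoc]
        gcongr
  exact ⟨fun c => key _ _ (h.linear c), fun n c => key _ _ (h.quadratic n c)⟩

/-- Two randomized shifts are bounded under a common equivalent probability measure. -/
theorem exists_isHSBounded [IsProbabilityMeasure μ] (hγ : IsGaussianSeq γ)
    (hz : Measurable z) (hzac : shiftLaw γ μ z ≪ γ)
    (hw : Measurable w) (hwac : shiftLaw γ μ w ≪ γ) :
    ∃ (μ' : Measure T) (R : ℝ), IsProbabilityMeasure μ' ∧ μ' ≪ μ ∧ μ ≪ μ' ∧ 0 ≤ R ∧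
      IsHSBounded μ' z R ∧ IsHSBounded μ' w R := by
  obtain ⟨h, hm, h0, h1, H⟩ := exists_weight_isHSBounded hγ hz hzac
  obtain ⟨k, km, k0, k1, HK⟩ := exists_weight_isHSBounded hγ hw hwac
  have hhk : Measurable (h * k) := hm.mul km
  -- Both weights are at most one, so the product is dominated by each; normalizing multiplies the
  -- constant `4` by `1 / ρ(T)`.
  set ρ := μ.withDensity (h * k) with hρ
  have hac : μ ≪ ρ := withDensity_absolutelyContinuous' hhk.aemeasurable
    (ae_of_all _ fun t => (ENNReal.mul_pos (h0 t).ne' (k0 t).ne').ne')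
  have hρle : ρ ≤ μ := by
    conv_rhs => rw [← withDensity_one (μ := μ)]
    exact withDensity_mono (ae_of_all _ fun t => mul_le_one' (h1 t) (k1 t))
  have hfin : IsFiniteMeasure ρ := isFiniteMeasure_of_le μ hρle
  have hne : NeZero ρ := ⟨fun h => by
    have := hac (show ρ Set.univ = 0 by rw [h]; simp)
    simp at this⟩
  have hu0 : ρ Set.univ ≠ 0 := (NeZero.ne (ρ Set.univ))
  have hut : ρ Set.univ ≠ ∞ := measure_ne_top _ _
  have hbd : (ρ Set.univ)⁻¹ * ENNReal.ofReal 4 ≤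
      ENNReal.ofReal ((ρ Set.univ)⁻¹ * ENNReal.ofReal 4).toReal := by
    rw [ENNReal.ofReal_toReal]
    exact ENNReal.mul_ne_top (ENNReal.inv_ne_top.2 hu0) ENNReal.ofReal_ne_top
  have smono : ∀ {ρ' : Measure T}, ρ ≤ ρ' → (ρ Set.univ)⁻¹ • ρ ≤ (ρ Set.univ)⁻¹ • ρ' :=
    fun hle => Measure.le_iff'.2 fun s => mul_le_mul_right (hle s) _
  refine ⟨(ρ Set.univ)⁻¹ • ρ, ((ρ Set.univ)⁻¹ * ENNReal.ofReal 4).toReal,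
    ⟨by simp⟩,
    (Measure.smul_absolutelyContinuous.trans (Measure.absolutelyContinuous_of_le hρle)),
    hac.trans (Measure.absolutelyContinuous_smul (ENNReal.inv_ne_zero.2 hut)),
    ENNReal.toReal_nonneg,
    H.mono (smono ?_) hbd ENNReal.toReal_nonneg (by norm_num),
    HK.mono (smono ?_) hbd ENNReal.toReal_nonneg (by norm_num)⟩
  · exact withDensity_mono (ae_of_all _ fun t => mul_le_of_le_one_right' (k1 t))
  · exact withDensity_mono (ae_of_all _ fun t => mul_le_of_le_one_left' (h1 t))

end GMC

/-! ### The covariance kernel as an `L²` limit -/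

namespace GMC

variable {T : Type*} [MeasurableSpace T] {μ : Measure T} {z w : T → ℕ → ℝ}

theorem memLp_two_of_lintegral_sq {f : T → ℝ} (hf : Measurable f)
    (h : ∫⁻ t, ENNReal.ofReal (f t ^ 2) ∂μ ≠ ∞) : MemLp f 2 μ := by
  rw [memLp_two_iff_integrable_sq hf.aestronglyMeasurable]
  refine ⟨(by fun_prop : Measurable fun t => f t ^ 2).aestronglyMeasurable, ?_⟩
  rw [hasFiniteIntegral_iff_ofReal (ae_of_all _ fun _ => sq_nonneg _)]
  exact h.lt_top

theorem integral_sq_le {f : T → ℝ} (hf : Measurable f) {C : ℝ} (hC : 0 ≤ C)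
    (h : ∫⁻ t, ENNReal.ofReal (f t ^ 2) ∂μ ≤ ENNReal.ofReal C) : ∫ t, f t ^ 2 ∂μ ≤ C := by
  rw [integral_eq_lintegral_of_nonneg_ae (ae_of_all _ fun _ => sq_nonneg _)
    (by fun_prop : Measurable fun t => f t ^ 2).aestronglyMeasurable]
  exact ENNReal.toReal_le_of_le_ofReal hC h

theorem memLp_two_mul_prod {S : Type*} [MeasurableSpace S] {ν : Measure S} [IsProbabilityMeasure μ]
    [IsProbabilityMeasure ν] {f : T → ℝ} {g : S → ℝ} (hf : MemLp f 2 μ) (hg : MemLp g 2 ν) :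
    MemLp (fun q : T × S => f q.1 * g q.2) 2 (μ.prod ν) := by
  have hm : AEStronglyMeasurable (fun q : T × S => f q.1 * g q.2) (μ.prod ν) :=
    hf.aestronglyMeasurable.comp_fst.mul hg.aestronglyMeasurable.comp_snd
  rw [memLp_two_iff_integrable_sq hm]
  refine (hf.integrable_sq.mul_prod hg.integrable_sq).congr (ae_of_all _ fun q => ?_)
  simp only [mul_pow]

theorem inner_toLp {f g : T → ℝ} (hf : MemLp f 2 μ) (hg : MemLp g 2 μ) :
    inner ℝ (hf.toLp f) (hg.toLp g) = ∫ t, f t * g t ∂μ := by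
  rw [L2.inner_def]
  refine integral_congr_ae ?_
  filter_upwards [hf.coeFn_toLp, hg.coeFn_toLp] with t h1 h2
  rw [h1, h2]
  simp [mul_comm]

theorem inner_tensor {S : Type*} [MeasurableSpace S] {ν : Measure S} [IsProbabilityMeasure μ]
    [IsProbabilityMeasure ν] {f f' : T → ℝ} {g g' : S → ℝ} (hf : MemLp f 2 μ) (hg : MemLp g 2 ν)
    (hf' : MemLp f' 2 μ) (hg' : MemLp g' 2 ν) :
    inner ℝ ((memLp_two_mul_prod hf hg).toLp _) ((memLp_two_mul_prod hf' hg').toLp _)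
      = (∫ t, f t * f' t ∂μ) * ∫ s, g s * g' s ∂ν := by
  rw [inner_toLp, ← integral_prod_mul]
  simp only [mul_mul_mul_comm]

theorem hsq_eq_sum_product (n : ℕ) (c : ℕ → ℕ → ℝ) :
    hsq n c = ∑ p ∈ Finset.range n ×ˢ Finset.range n, c p.1 p.2 ^ 2 := by
  rw [hsq, Finset.sum_product]

theorem hsq_nonneg (n : ℕ) (c : ℕ → ℕ → ℝ) : 0 ≤ hsq n c :=
  Finset.sum_nonneg fun _ _ => Finset.sum_nonneg fun _ _ => sq_nonneg _

theorem hsq_mono (c : ℕ → ℕ → ℝ) : Monotone fun n => hsq n c := by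
  intro m n h
  simp only [hsq_eq_sum_product]
  have := Finset.range_subset_range.2 h
  exact Finset.sum_le_sum_of_subset_of_nonneg (Finset.product_subset_product this this)
    fun _ _ _ => sq_nonneg _

/-- The diagonal block `[m, n)²` lies in `[0, n)²` and misses `[0, m)²`. -/
theorem sum_Ico_sq_le {m n : ℕ} (h : m ≤ n) (c : ℕ → ℕ → ℝ) :
    ∑ p ∈ Finset.Ico m n ×ˢ Finset.Ico m n, c p.1 p.2 ^ 2 ≤ hsq n c - hsq m c := by
  rw [le_sub_iff_add_le, hsq_eq_sum_product, hsq_eq_sum_product, ← Finset.sum_union]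
  · refine Finset.sum_le_sum_of_subset_of_nonneg (fun p hp => ?_) fun _ _ _ => sq_nonneg _
    simp only [Finset.mem_union, Finset.mem_product, Finset.mem_Ico, Finset.mem_range] at hp ⊢
    omega
  · rw [Finset.disjoint_left]
    intro p hp
    simp only [Finset.mem_product, Finset.mem_Ico, Finset.mem_range] at hp ⊢
    omega

/-- The Gram matrix of the coordinates of `z` in `L²(μ)`. -/
noncomputable def gram (μ : Measure T) (z : T → ℕ → ℝ) (i j : ℕ) : ℝ := ∫ t, z t i * z t j ∂μ

namespace IsHSBounded

variable {R : ℝ}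

theorem memLp_coord (h : IsHSBounded μ z R) (hz : Measurable z) (k : ℕ) :
    MemLp (fun t => z t k) 2 μ := by
  refine memLp_two_of_lintegral_sq (by fun_prop) ?_
  have := h.linear (Finsupp.single k 1)
  simp only [lf_single, one_mul] at this
  exact ne_top_of_le_ne_top ENNReal.ofReal_ne_top this

/-- A self-bounding argument: the quadratic form whose matrix is the Gram matrix has mean `S` and
second moment at most `R S`, and nonnegative variance forces `S² ≤ R S`. -/
theorem hsq_gram_le [IsProbabilityMeasure μ] (h : IsHSBounded μ z R) (hz : Measurable z)
    (hR : 0 ≤ R) (n : ℕ) : hsq n (gram μ z) ≤ R := by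
  set S := hsq n (gram μ z) with hS
  have hS0 : 0 ≤ S := hsq_nonneg _ _
  let q : T → ℝ := fun t => quad n (gram μ z) (z t) (z t)
  have hq : Measurable q := by fun_prop
  have hq2 := h.quadratic n (gram μ z)
  have hqL : MemLp q 2 μ :=
    memLp_two_of_lintegral_sq hq (ne_top_of_le_ne_top ENNReal.ofReal_ne_top hq2)
  have hsqle : ∫ t, q t ^ 2 ∂μ ≤ R * S := integral_sq_le hq (mul_nonneg hR hS0) hq2
  have hint : ∀ i j, Integrable (fun t => z t i * (gram μ z i j * z t j)) μ := fun i j =>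
    (h.memLp_coord hz i).integrable_mul ((h.memLp_coord hz j).const_mul _)
  have hmean : ∫ t, q t ∂μ = S := by
    simp only [q, quad, kerSum, Finset.mul_sum]
    rw [integral_finsetSum _ fun i _ => integrable_finsetSum _ fun j _ => hint i j, hS, hsq]
    refine Finset.sum_congr rfl fun i _ => ?_
    rw [integral_finsetSum _ fun j _ => hint i j]
    refine Finset.sum_congr rfl fun j _ => ?_
    simp_rw [mul_left_comm (z _ i)]
    rw [integral_const_mul, pow_two]
    rfl
  have hvar := variance_nonneg q μ
  rw [variance_eq_sub hqL] at hvar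
  simp only [Pi.pow_apply, hmean] at hvar
  by_contra hlt
  push Not at hlt
  nlinarith

/-- Convergence of the kernels `∑_{k < n} zₖ(t) wₖ(s)` in `L²(μ ⊗ μ)`. -/
theorem exists_kernel [IsProbabilityMeasure μ] (hR : 0 ≤ R) (hz : Measurable z)
    (hw : Measurable w) (hzb : IsHSBounded μ z R) (hwb : IsHSBounded μ w R) :
    ∃ K : T × T → ℝ, Measurable K ∧ MemLp K 2 (μ.prod μ) ∧
      (∀ f g : T → ℝ, MemLp f 2 μ → MemLp g 2 μ →
        Tendsto (fun n => ∑ k ∈ Finset.range n, (∫ t, f t * z t k ∂μ) * ∫ s, g s * w s k ∂μ) atTop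
          (𝓝 (∫ p : T × T, K p * (f p.1 * g p.2) ∂(μ.prod μ)))) ∧
      ∃ ns : ℕ → ℕ, StrictMono ns ∧ ∀ᵐ q ∂(μ.prod μ),
        Tendsto (fun j => kerSum (ns j) (z q.1) (w q.2)) atTop (𝓝 (K q)) := by
  have hzk := hzb.memLp_coord hz
  have hwk := hwb.memLp_coord hw
  let τ : ℕ → Lp ℝ 2 (μ.prod μ) := fun k => (memLp_two_mul_prod (hzk k) (hwk k)).toLp _
  have hτ : ∀ i j, inner ℝ (τ i) (τ j) = gram μ z i j * gram μ w i j := fun i j =>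
    inner_tensor (hzk i) (hwk i) (hzk j) (hwk j)
  let ζ : ℕ → Lp ℝ 2 (μ.prod μ) := fun n => ∑ k ∈ Finset.range n, τ k
  -- By `2ab ≤ a² + b²`, the Gram products of a block are bounded by increments of `S`, which is
  -- monotone and at most `R`, hence Cauchy.
  let S : ℕ → ℝ := fun n => (hsq n (gram μ z) + hsq n (gram μ w)) / 2
  have hdiff : ∀ m n, m ≤ n → ‖ζ n - ζ m‖ ^ 2 ≤ S n - S m := by
    intro m n hmn
    have e : ζ n - ζ m = ∑ k ∈ Finset.Ico m n, τ k := (Finset.sum_Ico_eq_sub _ hmn).symm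
    rw [e, ← real_inner_self_eq_norm_sq, sum_inner]
    simp_rw [inner_sum, hτ]
    rw [← Finset.sum_product' (f := fun i j => gram μ z i j * gram μ w i j)]
    have h1 := sum_Ico_sq_le hmn (gram μ z)
    have h2 := sum_Ico_sq_le hmn (gram μ w)
    have h3 : ∑ p ∈ Finset.Ico m n ×ˢ Finset.Ico m n, gram μ z p.1 p.2 * gram μ w p.1 p.2
        ≤ ∑ p ∈ Finset.Ico m n ×ˢ Finset.Ico m n,
          (gram μ z p.1 p.2 ^ 2 / 2 + gram μ w p.1 p.2 ^ 2 / 2) :=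
      Finset.sum_le_sum fun p _ => by nlinarith [sq_nonneg (gram μ z p.1 p.2 - gram μ w p.1 p.2)]
    rw [Finset.sum_add_distrib, ← Finset.sum_div, ← Finset.sum_div] at h3
    simp only [S]
    linarith
  have hScauchy : CauchySeq S := by
    refine (tendsto_atTop_ciSup (fun m n h => ?_) ⟨R, ?_⟩).cauchySeq
    · have h1 : hsq m (gram μ z) ≤ hsq n (gram μ z) := hsq_mono _ h
      have h2 : hsq m (gram μ w) ≤ hsq n (gram μ w) := hsq_mono _ h
      simp only [S]
      linarith
    · rintro _ ⟨n, rfl⟩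
      have h1 := hzb.hsq_gram_le hz hR n
      have h2 := hwb.hsq_gram_le hw hR n
      simp only [S]
      linarith
  have hζ : CauchySeq ζ := by
    rw [Metric.cauchySeq_iff']
    intro ε hε
    obtain ⟨N, hN⟩ := Metric.cauchySeq_iff'.1 hScauchy (ε ^ 2) (by positivity)
    refine ⟨N, fun n hn => ?_⟩
    have h1 := hdiff N n hn
    have h2 := hN n hn
    rw [Real.dist_eq] at h2
    rw [dist_eq_norm]
    exact lt_of_pow_lt_pow_left₀ 2 hε.le (h1.trans_lt ((le_abs_self _).trans_lt h2))
  obtain ⟨k, hk⟩ := cauchySeq_tendsto_of_complete hζ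
  have hkL : MemLp k 2 (μ.prod μ) := Lp.memLp k
  refine ⟨k, (Lp.stronglyMeasurable k).measurable, hkL, fun f g hf hg => ?_, ?_⟩
  · have hfg := memLp_two_mul_prod hf hg
    have h1 : Tendsto (fun n => inner ℝ (hfg.toLp _) (ζ n)) atTop (𝓝 (inner ℝ (hfg.toLp _) k)) :=
      tendsto_const_nhds.inner hk
    have h2 : inner ℝ (hfg.toLp _) k = ∫ p : T × T, k p * (f p.1 * g p.2) ∂(μ.prod μ) := by
      conv_lhs => rw [← Lp.toLp_coeFn k hkL]
      rw [inner_toLp]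
      simp only [mul_comm]
    rw [h2] at h1
    refine h1.congr fun n => ?_
    simp only [ζ, inner_sum]
    exact Finset.sum_congr rfl fun i _ => inner_tensor hf hg (hzk i) (hwk i)
  · obtain ⟨ns, hns, h⟩ := (tendstoInMeasure_of_tendsto_Lp hk).exists_seq_tendsto_ae
    refine ⟨ns, hns, ?_⟩
    have hcoe : ∀ᵐ q ∂(μ.prod μ), ∀ n, (ζ n : T × T → ℝ) q = kerSum n (z q.1) (w q.2) := by
      rw [ae_all_iff]
      intro n
      have h1 : ∀ᵐ q ∂(μ.prod μ), ∀ k, (τ k : T × T → ℝ) q = z q.1 k * w q.2 k :=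
        ae_all_iff.2 fun k => (memLp_two_mul_prod (hzk k) (hwk k)).coeFn_toLp
      filter_upwards [Lp.coeFn_finsetSum (Finset.range n) τ, h1] with q hq h1
      rw [hq]
      simp only [Finset.sum_apply, h1]
      rfl
    filter_upwards [h, hcoe] with q h1 h2
    simpa only [h2] using h1

end IsHSBounded

end GMC

/-! ### Uniqueness of the covariance kernel -/

namespace GMC

variable {T : Type*} [MeasurableSpace T] {μ : Measure T}

/-- Integrable functions on a product that have the same integrals over rectangles agree a.e. -/
theorem ae_eq_of_setIntegral_prod_eq {S : Type*} [MeasurableSpace S] {ρ : Measure (T × S)}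
    [IsFiniteMeasure ρ] {f g : T × S → ℝ} (hf : Integrable f ρ) (hg : Integrable g ρ)
    (h : ∀ B C, MeasurableSet B → MeasurableSet C →
      ∫ p in B ×ˢ C, f p ∂ρ = ∫ p in B ×ˢ C, g p ∂ρ) : f =ᵐ[ρ] g := by
  refine hf.ae_eq_of_forall_setIntegral_eq f g hg fun s hs hlt => ?_
  clear hlt
  induction s, hs using MeasurableSpace.induction_on_inter generateFrom_prod.symm
    isPiSystem_prod with
  | empty => simp
  | basic t ht =>
    obtain ⟨B, hB, C, hC, rfl⟩ := ht
    exact h B C hB hC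
  | compl t ht ih =>
    have hu := h Set.univ Set.univ MeasurableSet.univ MeasurableSet.univ
    rw [Set.univ_prod_univ, setIntegral_univ, setIntegral_univ] at hu
    rw [setIntegral_compl ht hf, setIntegral_compl ht hg, ih, hu]
  | iUnion A hd hm ih =>
    rw [integral_iUnion hm hd hf.integrableOn, integral_iUnion hm hd hg.integrableOn]
    simp only [ih]

section

variable {H : Type*} [NormedAddCommGroup H] [InnerProductSpace ℝ H]

/-- The integrals of a covariance kernel over rectangles, with respect to a smaller measure. -/
theorem setIntegral_covKernel {Z W : GenFun H μ} {K : T × T → ℝ} {ν lam : Measure T}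
    [IsProbabilityMeasure ν]
    (hker : ∀ f g : T → ℝ, MemLp f 2 ν → MemLp g 2 ν →
      ∃ a b : H, IsWeakIntegral ν f Z a ∧ IsWeakIntegral ν g W b ∧
        ∫ p : T × T, K p * (f p.1 * g p.2) ∂(ν.prod ν) = inner ℝ a b)
    (hle : lam ≤ ν) {B C : Set T} (hB : MeasurableSet B) (hC : MeasurableSet C) :
    ∃ a b : H, (∀ ξ, inner ℝ a ξ = ∫ t in B, Z.pair ξ t ∂lam) ∧
      (∀ ξ, inner ℝ b ξ = ∫ t in C, W.pair ξ t ∂lam) ∧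
      ∫ p in B ×ˢ C, K p ∂(lam.prod lam) = inner ℝ a b := by
  have hfin : IsFiniteMeasure lam := isFiniteMeasure_of_le ν hle
  have hac : lam ≪ ν := Measure.absolutelyContinuous_of_le hle
  set h := lam.rnDeriv ν with hh
  have hm : Measurable h := Measure.measurable_rnDeriv _ _
  -- The test function `1_B dλ/dν` turns integration against `ν` into integration against `λ`; it is
  -- bounded by one because `λ ≤ ν`.
  have hmem : ∀ B : Set T, MeasurableSet B → MemLp (B.indicator fun t => (h t).toReal) 2 ν := by
    intro B hB
    refine MemLp.of_bound (hm.ennreal_toReal.indicator hB).aestronglyMeasurable 1 ?_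
    filter_upwards [Measure.rnDeriv_le_one_of_le hle] with t ht
    refine (norm_indicator_le_norm_self _ _).trans ?_
    rw [Real.norm_eq_abs, abs_of_nonneg ENNReal.toReal_nonneg]
    exact ENNReal.toReal_le_of_le_ofReal zero_le_one (by simpa using ht)
  have hweak : ∀ (B : Set T) (Y : GenFun H μ) (a : H), MeasurableSet B →
      IsWeakIntegral ν (B.indicator fun t => (h t).toReal) Y a →
      ∀ ξ, inner ℝ a ξ = ∫ t in B, Y.pair ξ t ∂lam := by
    intro B Y a hB ha ξ
    rw [(ha ξ).2, ← setIntegral_rnDeriv_smul hac hB, ← integral_indicator hB]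
    refine integral_congr_ae (ae_of_all _ fun t => ?_)
    by_cases ht : t ∈ B <;> simp [ht, hh]
  obtain ⟨a, b, ha, hb, hab⟩ := hker _ _ (hmem B hB) (hmem C hC)
  refine ⟨a, b, hweak B Z a hB ha, hweak C W b hC hb, ?_⟩
  rw [← hab, ← integral_indicator (hB.prod hC)]
  conv_lhs => rw [← Measure.withDensity_rnDeriv_eq _ _ hac]
  rw [prod_withDensity hm hm, integral_withDensity_eq_integral_toReal_smul (by fun_prop) ?_]
  · refine integral_congr_ae (ae_of_all _ fun p => ?_)
    by_cases h1 : p.1 ∈ B <;> by_cases h2 : p.2 ∈ C <;>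
      simp [h1, h2, Set.indicator, Set.mem_prod, mul_comm]
  · have hlt : ∀ᵐ t ∂ν, h t < ∞ := Measure.rnDeriv_lt_top _ _
    filter_upwards [Measure.quasiMeasurePreserving_fst.ae hlt,
      Measure.quasiMeasurePreserving_snd.ae hlt] with p h1 h2
    exact ENNReal.mul_lt_top h1 h2

/-- The covariance kernel is unique up to a.e. equality. -/
theorem IsCovKernel.ae_eq [IsProbabilityMeasure μ] {Z W : GenFun H μ} {K K' : T × T → ℝ}
    (hK : IsCovKernel Z W K) (hK' : IsCovKernel Z W K') : K =ᵐ[μ.prod μ] K' := by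
  obtain ⟨ν₁, hp₁, hac₁, hac₁', -, -, hL₁, hker₁⟩ := hK.kernel
  obtain ⟨ν₂, hp₂, hac₂, hac₂', -, -, hL₂, hker₂⟩ := hK'.kernel
  -- The two kernels come with different reference measures. The minimum of the densities is
  -- dominated by both and still has `μ` absolutely continuous with respect to it.
  let lam := μ.withDensity fun t => min (ν₁.rnDeriv μ t) (ν₂.rnDeriv μ t)
  have hm : Measurable fun t => min (ν₁.rnDeriv μ t) (ν₂.rnDeriv μ t) := by fun_prop
  have hle₁ : lam ≤ ν₁ := by
    conv_rhs => rw [← Measure.withDensity_rnDeriv_eq _ _ hac₁]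
    exact withDensity_mono (ae_of_all _ fun t => min_le_left _ _)
  have hle₂ : lam ≤ ν₂ := by
    conv_rhs => rw [← Measure.withDensity_rnDeriv_eq _ _ hac₂]
    exact withDensity_mono (ae_of_all _ fun t => min_le_right _ _)
  have hμ : μ ≪ lam := by
    refine withDensity_absolutelyContinuous' hm.aemeasurable ?_
    filter_upwards [Measure.rnDeriv_pos' hac₁', Measure.rnDeriv_pos' hac₂'] with t h1 h2
    exact (lt_min h1 h2).ne'
  have hfin : IsFiniteMeasure lam := isFiniteMeasure_of_le ν₁ hle₁
  refine (hμ.prod hμ).ae_eq (ae_eq_of_setIntegral_prod_eq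
    ((hL₁.integrable one_le_two).mono_measure (Measure.prod_mono hle₁ hle₁))
    ((hL₂.integrable one_le_two).mono_measure (Measure.prod_mono hle₂ hle₂)) ?_)
  intro B C hB hC
  obtain ⟨a, b, ha, hb, h⟩ := setIntegral_covKernel hker₁ hle₁ hB hC
  obtain ⟨a', b', ha', hb', h'⟩ := setIntegral_covKernel hker₂ hle₂ hB hC
  -- The weak integrals depend only on `λ` and the set, no longer on the reference measure.
  have e1 : a = a' := ext_inner_right ℝ fun ξ => by rw [ha, ha']
  have e2 : b = b' := ext_inner_right ℝ fun ξ => by rw [hb, hb']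
  rw [h, h', e1, e2]

end

end GMC

/-! ### From the Hilbert space to coordinates -/

namespace GMC

variable {H : Type*} [NormedAddCommGroup H] [InnerProductSpace ℝ H]
  {Ω T : Type*} [MeasurableSpace Ω] [MeasurableSpace T] {P : Measure Ω} {μ ν : Measure T}
  (e : HilbertBasis ℕ ℝ H)

theorem GenFun.pair_add (Y : GenFun H μ) (ξ η : H) :
    Y.pair (ξ + η) =ᵐ[μ] Y.pair ξ + Y.pair η := by
  unfold GenFun.pair
  rw [map_add]
  exact AEEqFun.coeFn_add _ _

theorem GenFun.pair_smul (Y : GenFun H μ) (a : ℝ) (ξ : H) :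
    Y.pair (a • ξ) =ᵐ[μ] a • Y.pair ξ := by
  unfold GenFun.pair
  rw [map_smul]
  exact AEEqFun.coeFn_smul _ _

/-- The vector with coordinates `c`. -/
noncomputable def vec (c : ℕ →₀ ℝ) : H := Finsupp.linearCombination ℝ e c

theorem vec_add (c d : ℕ →₀ ℝ) : vec e (c + d) = vec e c + vec e d := map_add _ _ _

theorem vec_single (k : ℕ) (a : ℝ) : vec e (Finsupp.single k a) = a • e k := by
  simp [vec]

theorem vecCoords_vec (c : ℕ →₀ ℝ) : vecCoords e (vec e c) = c := by
  funext k
  exact e.orthonormal.inner_right_finsupp c k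

theorem norm_vec_sq (c : ℕ →₀ ℝ) : ‖vec e c‖ ^ 2 = nsq c := by
  rw [← real_inner_self_eq_norm_sq]
  conv_lhs => arg 2; rw [vec, Finsupp.linearCombination_apply]
  rw [Finsupp.sum_inner]
  refine Finset.sum_congr rfl fun k _ => ?_
  have := congrFun (vecCoords_vec e c) k
  simp only [vecCoords] at this
  change inner ℝ (c k • e k) (vec e c) = c k ^ 2
  rw [real_inner_smul_left, pow_two]
  exact congrArg _ this

/-- Linearity of `Y` holds only up to null sets, but a finitely supported `c` needs only finitely
many of them. -/
theorem GenFun.pair_vec (Y : GenFun H μ) (c : ℕ →₀ ℝ) :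
    ∀ᵐ t ∂μ, Y.pair (vec e c) t = lf c (Y.coords e t) := by
  induction c using Finsupp.induction_linear with
  | zero =>
    have := Y.pair_smul 0 (vec e 0)
    rw [zero_smul] at this
    filter_upwards [this] with t ht
    have h0 : (0 : H) = vec e 0 := (map_zero (Finsupp.linearCombination ℝ e)).symm
    rw [← h0, ht, Pi.smul_apply, zero_smul]
    simp [lf]
  | add c d hc hd =>
    filter_upwards [hc, hd, Y.pair_add (vec e c) (vec e d)] with t h1 h2 h3
    rw [vec_add, h3, lf_add_left, Pi.add_apply, h1, h2]
  | single k a =>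
    filter_upwards [Y.pair_smul a (e k)] with t ht
    rw [vec_single, ht, lf_single]
    rfl

/-- The law of the coordinates of a standard Gaussian. -/
theorem IsStdGaussian.isGaussianSeq [IsProbabilityMeasure P] {X : GenFun H P}
    (hX : IsStdGaussian X) : IsGaussianSeq (P.map (X.coords e)) where
  prob := Measure.isProbabilityMeasure_map (X.measurable_coords e).aemeasurable
  map_lf c := by
    rw [Measure.map_map (measurable_lf c) (X.measurable_coords e)]
    have h := hX (vec e c)
    rw [Measure.map_congr (X.pair_vec e c)] at h
    rw [show (nsq c).toNNReal = ‖vec e c‖₊ ^ 2 by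
      rw [← norm_vec_sq e, ← coe_nnnorm, ← NNReal.coe_pow, Real.toNNReal_coe]]
    exact h

theorem map_prod_coords [IsProbabilityMeasure P] [IsProbabilityMeasure μ] (X : GenFun H P) :
    (P.map (X.coords e)).prod μ = (P.prod μ).map (Prod.map (X.coords e) id) := by
  have := Measure.map_prod_map P μ (X.measurable_coords e) measurable_id
  rwa [Measure.map_id] at this

theorem IsRandomizedShift.shiftLaw [IsProbabilityMeasure P] [IsProbabilityMeasure μ]
    {X : GenFun H P} {Y : GenFun H μ} (h : IsRandomizedShift e X Y) :
    shiftLaw (P.map (X.coords e)) μ (Y.coords e) ≪ P.map (X.coords e) := by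
  have hY := Y.measurable_coords e
  unfold GMC.shiftLaw
  rw [map_prod_coords, Measure.map_map (by fun_prop)
    ((X.measurable_coords e).prodMap measurable_id)]
  exact h

/-- A chaos as a kernel on the law of the Gaussian, modified on a null set to be finite. -/
theorem IsGMC.exists_isChaos [StandardBorelSpace T] [IsProbabilityMeasure P] {X : GenFun H P} (hX : IsStdGaussian X)
    {Y : GenFun H μ} {M : Kernel (ℕ → ℝ) T} (hM : IsGMC e X Y M) (hE : expectation e X M = μ) :
    ∃ M' : Kernel (ℕ → ℝ) T, IsChaos (P.map (X.coords e)) μ (Y.coords e) M' ∧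
      ∀ᵐ x ∂(P.map (X.coords e)), M x = M' x := by
  classical
  have hγ := hX.isGaussianSeq e
  have hXm := X.measurable_coords e
  have hs : MeasurableSet {x | M x Set.univ < ∞} :=
    (M.measurable_coe MeasurableSet.univ) measurableSet_Iio
  have hfin : ∀ᵐ x ∂(P.map (X.coords e)), M x Set.univ < ∞ := by
    rw [ae_map_iff hXm.aemeasurable hs]
    filter_upwards [hM.finite] with ω hω using measure_lt_top _ _
  have hMM : ∀ᵐ x ∂(P.map (X.coords e)), M x = Kernel.piecewise hs M 0 x := by
    filter_upwards [hfin] with x hx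
    rw [Kernel.piecewise_apply, if_pos (by exact hx)]
  have hmean : (P.map (X.coords e)).bind M = μ := by
    rw [← hE, expectation, Measure.bind, Measure.bind, Measure.map_map M.measurable hXm]
    rfl
  have hmean' : (P.map (X.coords e)).bind (Kernel.piecewise hs M 0) = μ := by
    rw [← hmean]
    exact Measure.bind_congr_right (hMM.mono fun x hx => hx.symm)
  have hfin' : ∀ x, IsFiniteMeasure (Kernel.piecewise hs M 0 x) := by
    intro x
    rw [Kernel.piecewise_apply]
    split_ifs with hx
    · exact ⟨hx⟩
    · rw [zero_apply]; infer_instance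
  have hsf := isSFiniteKernel_of_isFiniteMeasure _ hfin'
  refine ⟨Kernel.piecewise hs M 0, ⟨hfin', hmean', fun c => ?_⟩, hMM⟩
  set M' := Kernel.piecewise hs M 0
  have hY := Y.measurable_coords e
  have hae : ∀ᵐ x ∂(P.map (X.coords e)), ∀ᵐ t ∂(M' x),
      Y.pair (vec e c) t = lf c (Y.coords e t) :=
    Measure.ae_ae_of_ae_bind M'.measurable.aemeasurable (by rw [hmean']; exact Y.pair_vec e c)
  -- The modification on a null set survives translation by `c`, because the translated Gaussian law
  -- is absolutely continuous.
  have hMM' : ∀ᵐ x ∂(P.map (X.coords e)), M (x + (c : ℕ → ℝ)) = M' (x + (c : ℕ → ℝ)) :=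
    ae_of_ae_map (by fun_prop) ((hγ.map_add_absolutelyContinuous c).ae_le hMM)
  -- Testing on one set `A` at a time makes the event measurable, as needed to pull it back along
  -- `X`.
  refine ae_eq_of_forall_measurableSet (ae_of_all _ fun x => hfin' _) fun A hA => ?_
  simp_rw [withDensity_apply _ hA]
  rw [ae_map_iff hXm.aemeasurable]
  · filter_upwards [hM.shift (vec e c), ae_of_ae_map hXm.aemeasurable hMM,
      ae_of_ae_map hXm.aemeasurable hMM', ae_of_ae_map hXm.aemeasurable hae] with ω h1 h2 h3 h4
    rw [vecCoords_vec, h3, h2] at h1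
    rw [h1, withDensity_apply _ hA]
    refine setLIntegral_congr_fun_ae hA ?_
    filter_upwards [h4] with t ht _
    rw [ht]
  · refine measurableSet_eq_fun ((M'.measurable_coe hA).comp (by fun_prop)) ?_
    exact Measurable.setLIntegral_kernel_prod_right (κ := M')
      (f := fun _ t => ENNReal.ofReal (Real.exp (lf c (Y.coords e t)))) (by fun_prop) hA

/-- Bounds on the coordinates of `Y` extend to all its linear functionals. -/
theorem IsHSBounded.lintegral_pair_sq_le {Y : GenFun H μ} {R : ℝ} (hb : IsHSBounded ν (Y.coords e) R)
    (hν : ν ≪ μ) (ξ : H) :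
    ∫⁻ t, ENNReal.ofReal (Y.pair ξ t ^ 2) ∂ν ≤ ENNReal.ofReal (R * ‖ξ‖ ^ 2) := by
  let c : ℕ → ℕ →₀ ℝ := fun n => trunc 1 n (vecCoords e ξ)
  have hc : ∀ n, vec e (c n) = ∑ k ∈ Finset.range n, e.repr ξ k • e k := by
    intro n
    rw [vec, Finsupp.linearCombination_apply]
    simp only [c, trunc]
    rw [Finsupp.onFinset_sum _ (by simp)]
    refine Finset.sum_congr rfl fun k hk => ?_
    simp [cut, Finset.mem_range.1 hk, vecCoords, HilbertBasis.repr_apply_apply]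
  have hlim : Tendsto (fun n => vec e (c n)) atTop (𝓝 ξ) := by
    simp_rw [hc]
    exact (e.hasSum_repr ξ).tendsto_sum_nat
  -- Continuity in measure gives a.e. convergence along a subsequence, and Fatou carries the bound
  -- to the limit.
  obtain ⟨ns, hns, hae⟩ := (Y.cont _ _ hlim).exists_seq_tendsto_ae
  have hlf : ∀ᵐ t ∂ν, ∀ n, Y.pair (vec e (c n)) t = lf (c n) (Y.coords e t) :=
    ae_all_iff.2 fun n => hν.ae_le (Y.pair_vec e (c n))
  have hY := Y.measurable_coords e
  calc ∫⁻ t, ENNReal.ofReal (Y.pair ξ t ^ 2) ∂ν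
      = ∫⁻ t, liminf (fun j => ENNReal.ofReal (lf (c (ns j)) (Y.coords e t) ^ 2)) atTop ∂ν := by
        refine lintegral_congr_ae ?_
        filter_upwards [hν.ae_le hae, hlf] with t h1 h2
        have h3 : Tendsto (fun j => lf (c (ns j)) (Y.coords e t)) atTop (𝓝 (Y.pair ξ t)) :=
          h1.congr fun j => h2 (ns j)
        exact (ENNReal.tendsto_ofReal (h3.pow 2)).liminf_eq.symm
    _ ≤ liminf (fun j => ∫⁻ t, ENNReal.ofReal (lf (c (ns j)) (Y.coords e t) ^ 2) ∂ν) atTop :=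
        lintegral_liminf_le fun j => by fun_prop
    _ ≤ liminf (fun j => ENNReal.ofReal (R * ‖vec e (c (ns j))‖ ^ 2)) atTop := by
        refine liminf_le_liminf (Eventually.of_forall fun j => ?_)
        rw [norm_vec_sq]
        exact hb.linear _
    _ = ENNReal.ofReal (R * ‖ξ‖ ^ 2) :=
        (ENNReal.tendsto_ofReal (((hlim.comp hns.tendsto_atTop).norm.pow 2).const_mul R)).liminf_eq

theorem IsHSBounded.memLp_pair {Y : GenFun H μ} {R : ℝ} (hb : IsHSBounded ν (Y.coords e) R)
    (hν : ν ≪ μ) (ξ : H) : MemLp (Y.pair ξ) 2 ν :=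
  memLp_two_of_lintegral_sq (Y.measurable_pair ξ)
    (ne_top_of_le_ne_top ENNReal.ofReal_ne_top (hb.lintegral_pair_sq_le e hν ξ))

/-- Weak integrals of square integrable functions exist. -/
theorem IsHSBounded.exists_isWeakIntegral [CompleteSpace H] {Y : GenFun H μ} {R : ℝ}
    (hb : IsHSBounded ν (Y.coords e) R) (hR : 0 ≤ R) (hν : ν ≪ μ) {f : T → ℝ} (hf : MemLp f 2 ν) :
    ∃ a : H, IsWeakIntegral ν f Y a := by
  have hL := hb.memLp_pair e hν
  let A : H →ₗ[ℝ] Lp ℝ 2 ν :=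
    { toFun := fun ξ => (hL ξ).toLp _
      map_add' := fun ξ η => by
        rw [← MemLp.toLp_add]
        exact MemLp.toLp_congr _ _ (hν.ae_le (Y.pair_add ξ η))
      map_smul' := fun a ξ => by
        rw [RingHom.id_apply, ← MemLp.toLp_const_smul]
        exact MemLp.toLp_congr _ _ (hν.ae_le (Y.pair_smul a ξ)) }
  have hA : ∀ ξ, ‖A ξ‖ ≤ √R * ‖ξ‖ := by
    intro ξ
    refine abs_le_of_sq_le_sq' ?_ (by positivity) |>.2
    rw [mul_pow, Real.sq_sqrt hR, ← real_inner_self_eq_norm_sq]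
    refine (inner_toLp (hL ξ) (hL ξ)).trans_le ?_
    simp_rw [← pow_two]
    exact integral_sq_le (Y.measurable_pair ξ) (by positivity) (hb.lintegral_pair_sq_le e hν ξ)
  -- The map `ξ ↦ ⟨Y, ξ⟩` is bounded from `H` to `L²(ν)`; the weak integral of `f` is its adjoint
  -- applied to `f`.
  refine ⟨ContinuousLinearMap.adjoint (A.mkContinuous _ hA) (hf.toLp f), fun ξ =>
    ⟨hf.integrable_mul (hL ξ), ?_⟩⟩
  rw [ContinuousLinearMap.adjoint_inner_left]
  exact inner_toLp hf (hL ξ)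

/-- Existence of the covariance kernel, as a limit of `∑_{k < n} ⟨Z(t), eₖ⟩ ⟨W(s), eₖ⟩`. -/
theorem exists_isCovKernel [CompleteSpace H] [IsProbabilityMeasure P] [IsProbabilityMeasure μ]
    {X : GenFun H P} (hX : IsStdGaussian X) {Z W : GenFun H μ} (hZ : IsRandomizedShift e X Z)
    (hW : IsRandomizedShift e X W) :
    ∃ K : T × T → ℝ, IsCovKernel Z W K ∧ ∃ ns : ℕ → ℕ, StrictMono ns ∧ ∀ᵐ q ∂(μ.prod μ),
      Tendsto (fun j => kerSum (ns j) (Z.coords e q.1) (W.coords e q.2)) atTop (𝓝 (K q)) := by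
  have hz := Z.measurable_coords e
  have hw := W.measurable_coords e
  obtain ⟨ν, R, hν, hac, hac', hR, hzb, hwb⟩ := exists_isHSBounded (hX.isGaussianSeq e) hz
    (hZ.shiftLaw e) hw (hW.shiftLaw e)
  obtain ⟨K, hKm, hKL, hK, ns, hns, hlim⟩ := IsHSBounded.exists_kernel hR hz hw hzb hwb
  refine ⟨K, ⟨hKm, ν, hν, hac, hac', hzb.memLp_pair e hac, hwb.memLp_pair e hac, hKL,
    fun f g hf hg => ?_⟩, ns, hns, (hac'.prod hac').ae_le hlim⟩
  obtain ⟨a, ha⟩ := hzb.exists_isWeakIntegral e hR hac hf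
  obtain ⟨b, hb⟩ := hwb.exists_isWeakIntegral e hR hac hg
  refine ⟨a, b, ha, hb, tendsto_nhds_unique (hK f g hf hg) ?_⟩
  -- Parseval: the coordinates of `a` and `b` are the integrals appearing in the partial sums.
  refine (e.hasSum_inner_mul_inner a b).tendsto_sum_nat.congr fun n => ?_
  refine Finset.sum_congr rfl fun k _ => ?_
  rw [real_inner_comm b (e k), (ha (e k)).2, (hb (e k)).2]
  rfl

end GMC

/-! ### Assembly -/

namespace GMC

variable {H : Type*} [NormedAddCommGroup H] [InnerProductSpace ℝ H]
  {Ω T : Type*} [MeasurableSpace Ω] [MeasurableSpace T] {P : Measure Ω} {μ : Measure T}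
  (e : HilbertBasis ℕ ℝ H)

theorem IsChaos.lintegral_prod_coords [IsProbabilityMeasure P] {X : GenFun H P}
    {MZ MW MZ' MW' : Kernel (ℕ → ℝ) T} {z w : T → ℕ → ℝ}
    (hZ : IsChaos (P.map (X.coords e)) μ z MZ') (hW : IsChaos (P.map (X.coords e)) μ w MW')
    (hZZ : ∀ᵐ x ∂(P.map (X.coords e)), MZ x = MZ' x)
    (hWW : ∀ᵐ x ∂(P.map (X.coords e)), MW x = MW' x) {B : Set (T × T)} (hB : MeasurableSet B) :
    ∫⁻ ω, ((MZ (X.coords e ω)).prod (MW (X.coords e ω))) B ∂P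
      = ∫⁻ x, ((MZ' x).prod (MW' x)) B ∂(P.map (X.coords e)) := by
  have := hZ.isSFiniteKernel
  have := hW.isSFiniteKernel
  have hXm := X.measurable_coords e
  have hm : Measurable fun x => ((MZ' x).prod (MW' x)) B := by
    have := (MZ' ×ₖ MW').measurable_coe hB
    simpa only [Kernel.prod_apply] using this
  rw [lintegral_map hm hXm]
  refine lintegral_congr_ae ?_
  filter_upwards [ae_of_ae_map hXm.aemeasurable hZZ, ae_of_ae_map hXm.aemeasurable hWW] with ω h1 h2
  rw [h1, h2]

end GMC

theorem mainTheorem7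
    {H : Type*} [NormedAddCommGroup H] [InnerProductSpace ℝ H] [CompleteSpace H]
    (e : HilbertBasis ℕ ℝ H)
    {Ω : Type*} [MeasurableSpace Ω] [StandardBorelSpace Ω] (P : Measure Ω) [IsProbabilityMeasure P]
    {T : Type*} [MeasurableSpace T] [StandardBorelSpace T] (μ : Measure T) [IsProbabilityMeasure μ]
    (X : GMC.GenFun H P) (hX : GMC.IsStdGaussian X)
    (Z W : GMC.GenFun H μ)
    (hZ : GMC.IsRandomizedShift e X Z) (hW : GMC.IsRandomizedShift e X W)
    (MZ MW : Kernel (ℕ → ℝ) T)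
    (hMZ : GMC.IsSubcriticalGMC e X Z MZ) (hMW : GMC.IsSubcriticalGMC e X W MW)
    (hEZ : GMC.expectation e X MZ = μ) (hEW : GMC.expectation e X MW = μ) :
    -- the kernel `K(t, s) = ⟨Z(t), W(s)⟩` is well defined as a function
    (∃ K : T × T → ℝ, GMC.IsCovKernel Z W K) ∧
    (∀ K K' : T × T → ℝ, GMC.IsCovKernel Z W K → GMC.IsCovKernel Z W K' → K =ᵐ[μ.prod μ] K') ∧
    (∀ K : T × T → ℝ, GMC.IsCovKernel Z W K →
      -- `M_Z(X + W(s), dt) = e^{K(t, s)} M_Z(X, dt)`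
      (∀ᵐ p : Ω × T ∂(P.prod μ),
        MZ (X.coords e p.1 + W.coords e p.2) =
          (MZ (X.coords e p.1)).withDensity
            fun t => ENNReal.ofReal (Real.exp (K (t, p.2)))) ∧
      -- `E [M_Z ⊗ M_W] = e^K · μ ⊗ μ`
      (∀ B : Set (T × T), MeasurableSet B →
        ∫⁻ ω, ((MZ (X.coords e ω)).prod (MW (X.coords e ω))) B ∂P =
          ((μ.prod μ).withDensity fun p => ENNReal.ofReal (Real.exp (K p))) B)) ∧
    -- nonatomicity
    ((∀ t : T, μ {t} = 0) → ∀ᵐ ω ∂P, ∀ t : T, MZ (X.coords e ω) {t} = 0) := by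
  have hγ := hX.isGaussianSeq e
  have := hγ.prob
  have hXm := X.measurable_coords e
  have hw := W.measurable_coords e
  obtain ⟨NZ, hNZ, hZZ⟩ := hMZ.toIsGMC.exists_isChaos e hX hEZ
  obtain ⟨NW, hNW, hWW⟩ := hMW.toIsGMC.exists_isChaos e hX hEW
  obtain ⟨K₀, hK₀, ns, hns, hlim₀⟩ := GMC.exists_isCovKernel e hX hZ hW
  refine ⟨⟨K₀, hK₀⟩, fun K K' hK hK' => hK.ae_eq hK', fun K hK => ?_, fun hμ => ?_⟩
  -- Uniqueness transfers the a.e. approximation from the constructed kernel to an arbitrary one.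
  · have hlim : ∀ᵐ q ∂(μ.prod μ), Tendsto (fun j => GMC.kerSum (ns j) (Z.coords e q.1)
        (W.coords e q.2)) atTop (𝓝 (K q)) := by
      filter_upwards [hlim₀, hK₀.ae_eq hK] with q h1 h2
      rwa [← h2]
    have hs := hNZ.ae_shift hγ (Z.measurable_coords e) hw (hW.shiftLaw e) hK.measurable hns hlim
    refine ⟨?_, fun B hB => ?_⟩
    · have hs' := hs
      rw [GMC.map_prod_coords] at hs'
      have h1 := ae_of_ae_map (hXm.prodMap measurable_id).aemeasurable hs'
      have h2 : ∀ᵐ p : Ω × T ∂(P.prod μ), MZ (X.coords e p.1) = NZ (X.coords e p.1) :=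
        Measure.quasiMeasurePreserving_fst.ae (ae_of_ae_map hXm.aemeasurable hZZ)
      -- The null set where `MZ` and `NZ` differ is not charged by the law of `X + W`: this is the
      -- randomized shift property.
      have h3 : ∀ᵐ p : Ω × T ∂(P.prod μ), MZ (X.coords e p.1 + W.coords e p.2)
          = NZ (X.coords e p.1 + W.coords e p.2) :=
        ae_of_ae_map (by fun_prop) (hW.ae_le hZZ)
      filter_upwards [h1, h2, h3] with p h1 h2 h3
      rw [h3, h2]
      exact h1
    · rw [GMC.IsChaos.lintegral_prod_coords e hNZ hNW hZZ hWW hB]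
      exact hNZ.lintegral_prod_apply hγ hNW hw hK.measurable hs hB
  -- Nonatomicity needs the second moment of `M_Z` with itself, hence the kernel of the pair `Z, Z`.
  · obtain ⟨K, hK, ms, hms, hlim⟩ := GMC.exists_isCovKernel e hX hZ hZ
    have hz := Z.measurable_coords e
    have hs := hNZ.ae_shift hγ hz hz (hZ.shiftLaw e) hK.measurable hms hlim
    have hat := hNZ.ae_nonatomic
      (fun B hB => hNZ.lintegral_prod_apply hγ hNZ hz hK.measurable hs hB) hμ
    filter_upwards [ae_of_ae_map hXm.aemeasurable hat, ae_of_ae_map hXm.aemeasurable hZZ]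
      with ω h1 h2 t
    rw [h2]
    exact h1 t
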